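/- Let $\mathfrak S_n$ be the set of permutations $\sigma$ of $[n]=\{1,\dots,n\}$, with the convention $\sigma(0)=\sigma(n+1)=0$. Let $\mathsf{des}\,\sigma=\#\{i\in[n-1]:\sigma(i)>\sigma(i+1)\}$, $\mathsf{exc}\,\sigma=\#\{i\in[n]:\sigma(i)>i\}$, $\mathsf{inv}\,\sigma=\#\{(i,j):1\le i<j\le n,\ \sigma(i)>\sigma(j)\}$, $\mathsf{dd}\,\sigma=\#\{i\in[n]:\sigma(i-1)>\sigma(i)>\sigma(i+1)\}$, and $$(31\text{-}2)\sigma=\sum_{i=1}^n\#\{j:1<j<i,\ \sigma(j)<\sigma(i)<\sigma(j-1)\},\qquad (2\text{-}13)\sigma=\sum_{i=1}^n\#\{j:i<j<n,\ \sigma(j)<\sigma(i)<\sigma(j+1)\}.$$ Let $\sigma^*$ be the permutation of $\{0,1,\dots,n\}$ given by $\sigma^*(0)=n$ and $\sigma^*(i)=\sigma(i)-1$ for $i\in[n]$, and let $\mathsf{cda}^*\sigma=\#\{i\in[n-1]:(\sigma^*)^{-1}(i)<i<\sigma^*(i)\}$ and $\mathsf{fix}^*\sigma=\#\{i\in[n-1]:\sigma^*(i)=i\}$.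 Let $\mathsf{scda}\,\sigma=\#\{i\in[n-1]: i<\sigma(i),\ i+1>\sigma^{-1}(i+1)\}$ be the number of shifted cyclic double excedances of $\sigma$. Put $$\mathrm{DD}_{n,k}=\{\sigma\in\mathfrak S_n:\mathsf{des}\,\sigma=k,\ \mathsf{dd}\,\sigma=0\},\quad \mathrm{DE}^*_{n,k}=\{\sigma\in\mathfrak S_n:\mathsf{exc}\,\sigma=k,\ \mathsf{cda}^*\sigma+\mathsf{fix}^*\sigma=0\},$$ $$\mathrm{SDE}_{n,k}=\{\sigma\in\mathfrak S_n:\mathsf{exc}\,\sigma=k,\ \mathsf{scda}\,\sigma=0\}.$$ Theorem. For all integers $n,k$ with $0\le k\le (n-1)/2$, the polynomial $$\gamma_{n,k}(q):=\sum_{\sigma\in \mathrm{DD}_{n,k}}q^{2(31\text{-}2)\sigma+(2\text{-}13)\sigma}$$ satisfies $$\gamma_{n,k}(q)=\sum_{\sigma\in \mathrm{DE}^*_{n,k}}q^{\mathsf{inv}\,\sigma-\mathsf{exc}\,\sigma}=\sum_{\sigma\in \mathrm{SDE}_{n,k}}q^{\mathsf{inv}\,\sigma-\mathsf{exc}\,\sigma}.$$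 -/

import Mathlib

open Finset Polynomial

namespace PermStat

/-- The one-line word of a permutation `σ` of `[n] = {1, …, n}`, with the convention
`σ(0) = σ(n+1) = 0`: `word σ i` is `σ(i)` for `1 ≤ i ≤ n`, and `0` for every other `i`.
(The type `Fin n` is `{0, …, n-1}`, whence the shift by one.) -/
def word {n : ℕ} (σ : Equiv.Perm (Fin n)) (i : ℕ) : ℕ :=
  if h : 1 ≤ i ∧ i ≤ n then (σ ⟨i - 1, by omega⟩ : ℕ) + 1 else 0

/-- Number of descents: `i ∈ [n-1]` with `σ(i) > σ(i+1)`. -/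
def des {n : ℕ} (σ : Equiv.Perm (Fin n)) : ℕ :=
  #{i ∈ Icc 1 (n - 1) | word σ (i + 1) < word σ i}

/-- Number of excedances: indices `i` with `σ(i) > i`. -/
def exc {n : ℕ} (σ : Equiv.Perm (Fin n)) : ℕ :=
  #{i ∈ Icc 1 n | i < word σ i}

/-- Number of inversions: pairs `i < j` with `σ(i) > σ(j)`. -/
def inv {n : ℕ} (σ : Equiv.Perm (Fin n)) : ℕ :=
  #{p ∈ Icc 1 n ×ˢ Icc 1 n | p.1 < p.2 ∧ word σ p.2 < word σ p.1}

/-- Number of double descents, with the convention `σ(0) = σ(n+1) = 0`. They are counted by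
their positions `i`, which determine the values `σ(i)` and are determined by them. -/
def dd {n : ℕ} (σ : Equiv.Perm (Fin n)) : ℕ :=
  #{i ∈ Icc 1 n | word σ i < word σ (i - 1) ∧ word σ (i + 1) < word σ i}

/-- `(31-2)_i σ = #{j : 1 < j < i, σ(j) < σ(i) < σ(j-1)}`. -/
def v31_2At {n : ℕ} (σ : Equiv.Perm (Fin n)) (i : ℕ) : ℕ :=
  #{j ∈ Ioo 1 i | word σ j < word σ i ∧ word σ i < word σ (j - 1)}

/-- `(2-13)_i σ = #{j : i < j < n, σ(j) < σ(i) < σ(j+1)}`. -/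
def v2_13At {n : ℕ} (σ : Equiv.Perm (Fin n)) (i : ℕ) : ℕ :=
  #{j ∈ Ioo i n | word σ j < word σ i ∧ word σ i < word σ (j + 1)}

/-- `(31-2) σ`, the number of occurrences of the vincular pattern `31-2`. -/
def v31_2 {n : ℕ} (σ : Equiv.Perm (Fin n)) : ℕ := ∑ i ∈ Icc 1 n, v31_2At σ i

/-- `(2-13) σ`, the number of occurrences of the vincular pattern `2-13`. -/
def v2_13 {n : ℕ} (σ : Equiv.Perm (Fin n)) : ℕ := ∑ i ∈ Icc 1 n, v2_13At σ i

/-- The star companion `σ*`, the permutation of `{0, …, n}` with `σ*(0) = n` and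
`σ*(i) = σ(i) - 1` for `1 ≤ i ≤ n`. -/
def star {n : ℕ} (σ : Equiv.Perm (Fin n)) : Equiv.Perm (Fin (n + 1)) where
  toFun := Fin.cases (Fin.last n) fun i => (σ i).castSucc
  invFun := Fin.lastCases 0 fun i => (σ.symm i).succ
  left_inv i := by refine Fin.cases ?_ (fun i => ?_) i <;> simp
  right_inv i := by refine Fin.lastCases ?_ (fun i => ?_) i <;> simp

theorem star_zero {n : ℕ} (σ : Equiv.Perm (Fin n)) : (star σ 0 : ℕ) = n := by
  simp [star]

theorem star_eq {n : ℕ} (σ : Equiv.Perm (Fin n)) (i : Fin (n + 1)) (hi : i ≠ 0) :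
    (star σ i : ℕ) = word σ i - 1 := by
  obtain ⟨j, rfl⟩ := Fin.exists_succ_eq.2 hi
  have hj : (j : ℕ) + 1 ≤ n := j.isLt
  simp [star, word, hj]

/-- `cda* σ`, the number of `i ∈ [n-1]` with `(σ*)⁻¹(i) < i < σ*(i)`. -/
def cdaStar {n : ℕ} (σ : Equiv.Perm (Fin n)) : ℕ :=
  #{i : Fin (n + 1) | (1 ≤ (i : ℕ) ∧ (i : ℕ) ≤ n - 1) ∧ (star σ)⁻¹ i < i ∧ i < star σ i}

/-- `fix* σ`, the number of `i ∈ [n-1]` with `i = σ*(i)`. -/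
def fixStar {n : ℕ} (σ : Equiv.Perm (Fin n)) : ℕ :=
  #{i : Fin (n + 1) | (1 ≤ (i : ℕ) ∧ (i : ℕ) ≤ n - 1) ∧ i = star σ i}

/-- Number of shifted cyclic double excedances: `i ∈ [n-1]` with `i < σ(i)` and
`i + 1 > σ⁻¹(i+1)`. -/
def scda {n : ℕ} (σ : Equiv.Perm (Fin n)) : ℕ :=
  #{i ∈ Icc 1 (n - 1) | i < word σ i ∧ word σ⁻¹ (i + 1) < i + 1}

/-- Permutations of `[n]` with `k` descents and no double descent. -/
def DD (n k : ℕ) : Finset (Equiv.Perm (Fin n)) := {σ | des σ = k ∧ dd σ = 0}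

/-- Permutations of `[n]` with `k` excedances and `cda* + fix* = 0`. -/
def DEStar (n k : ℕ) : Finset (Equiv.Perm (Fin n)) :=
  {σ | exc σ = k ∧ cdaStar σ + fixStar σ = 0}

/-- Permutations of `[n]` with `k` excedances and no shifted cyclic double excedance. -/
def SDE (n k : ℕ) : Finset (Equiv.Perm (Fin n)) := {σ | exc σ = k ∧ scda σ = 0}

/-- `γ_{n,k}(q) = ∑_{σ ∈ DD_{n,k}} q^{2(31-2)σ + (2-13)σ}`, a polynomial in `q = X`. -/
noncomputable def gammaPoly (n k : ℕ) : ℤ[X] :=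
  ∑ σ ∈ DD n k, X ^ (2 * v31_2 σ + v2_13 σ)

/-- Every excedance is the left end of an inversion; hence `inv σ - exc σ` is an honest
natural number, and `X ^ (inv σ - exc σ)` involves no truncated subtraction. -/
theorem exc_le_inv {n : ℕ} (σ : Equiv.Perm (Fin n)) : exc σ ≤ inv σ := by
  have key : ∀ i ∈ Icc 1 n, i < word σ i →
      ∃ j ∈ Icc 1 n, i < j ∧ word σ j < word σ i := by
    intro i hi hlt
    rw [mem_Icc] at hi
    have hw : word σ i = (σ ⟨i - 1, by omega⟩ : ℕ) + 1 := by simp [word, hi]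
    by_contra! hcon
    -- otherwise the `i` smallest values all sit strictly to the left of position `i`
    have hmap : ∀ v ∈ range i, (fun v => if h : v < n then (σ.symm ⟨v, h⟩ : ℕ) else 0) v ∈
        range (i - 1) := by
      intro v hv
      rw [mem_range] at hv
      have hvn : v < n := by omega
      simp only [hvn, dite_true, mem_range]
      by_contra hge
      set j := σ.symm ⟨v, hvn⟩ with hj
      have hσj : σ j = ⟨v, hvn⟩ := by simp [hj]
      have hjn : (j : ℕ) < n := j.isLt
      have hwj : word σ ((j : ℕ) + 1) = v + 1 := by
        have : (j : ℕ) + 1 ≤ n := hjn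
        simp [word, this, hσj]
      rcases Nat.lt_or_ge i ((j : ℕ) + 1) with h | h
      · have := hcon ((j : ℕ) + 1) (by simp) h
        omega
      · have : (j : ℕ) + 1 = i := by omega
        rw [this] at hwj
        omega
    obtain ⟨a, ha, b, hb, hab, he⟩ :=
      exists_ne_map_eq_of_card_lt_of_maps_to (by simp; omega) hmap
    rw [mem_range] at ha hb
    have ha' : a < n := by omega
    have hb' : b < n := by omega
    simp only [ha', hb', dite_true] at he
    have := σ.symm.injective (Fin.ext he)
    exact hab (by simpa using this)
  unfold exc inv
  refine card_le_card_of_surjOn Prod.fst ?_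
  intro i hi
  simp only [coe_filter, Set.mem_ofPred_eq] at hi
  obtain ⟨j, hj, h1, h2⟩ := key i hi.1 hi.2
  exact ⟨(i, j), by simpa using ⟨⟨by simpa using hi.1, by simpa using hj⟩, h1, h2⟩, rfl⟩

end PermStat

/-! Both sides are grown one step at a time while recording only a level and a counter, and the two
resulting transfer operators are conjugate by a diagonal factor.

Descent side. Pad σ to 0 σ(1) … σ(n) 0 and insert the letters 1, 2, …, n in increasing order, a hole
`H` standing for a maximal block of letters still to come; the start is 0 H 0. A letter u enters a
hole as u, uH or HuH. The fourth choice Hu is excluded, because u would become a double descent.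
With l other holes on its left and r on its right, u plays the 2 in l occurrences of 31-2 and in r
of 2-13, at cost q^(2l+r). Summed over the b = l + r + 1 holes this is q^(b-1)[b], and only HuH
creates a descent: this is `wordStep` (`wordWeight_fill`, `wordSum_succ`).

Excedance side. Read the graph of σ on the boards [i] × [i+1]. The condition scda σ = 0 says that if
column i+1 has its rook in a row ≤ i, then σ(i) ≤ i. Hence passing to the next board either leaves
row i+1 open, or gives it a rook in an old column, or does the latter and also fills column i+2 from
an open row (`IsPartial.eq_restrict_or`). An open row is a future excedance, and inversions are
counted as soon as they are forced. With h open rows this yields `rookStep` (`rookSum_succ`).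

The substitution b = h + 1 and the factor `gauge` turn one operator into the other
(`rookStep_gauge`). The n insertions exceed the n - 1 board steps by one, which is the closing of
the last hole. Finally `DEStar` and `SDE` are the same set. -/

namespace PermStat

/-! ### Transfer operators -/

/-- The `q`-number `1 + q + ⋯ + q^(m-1)`. -/
noncomputable def qNum (m : ℕ) : ℤ[X] := ∑ i ∈ range m, X ^ i

@[simp] theorem qNum_zero : qNum 0 = 0 := by simp [qNum]

@[simp] theorem qNum_one : qNum 1 = 1 := by simp [qNum]

/-- One step of the transfer operator attached to partial rook placements. -/
noncomputable def rookStep (φ : ℕ → ℕ → ℤ[X]) (h k : ℕ) : ℤ[X] :=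
  φ (h + 1) (k + 1) + X ^ h * qNum (h + 1) * φ h k +
    X ^ (2 * h - 1) * qNum h * qNum (h + 1) * φ (h - 1) k

/-- One step of the transfer operator attached to words with holes. -/
noncomputable def wordStep (ψ : ℕ → ℕ → ℤ[X]) (b k : ℕ) : ℤ[X] :=
  X ^ (b - 1) * qNum b * (ψ (b + 1) (k + 1) + ψ b k + ψ (b - 1) k)

theorem wordStep_zero (ψ : ℕ → ℕ → ℤ[X]) (k : ℕ) : wordStep ψ 0 k = 0 := by
  simp [wordStep]

/-- The gauge factor relating the two transfer operators. -/
noncomputable def gauge (h : ℕ) : ℤ[X] := ∏ j ∈ range h, X ^ j * qNum (j + 1)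

/-- Since `gauge (h + 1) = gauge h * (X ^ h * qNum (h + 1))`, all three terms of `rookStep` acquire
the common factor `X ^ h * qNum (h + 1)`. At the ground level the downward term dies on one side
through `qNum 0 = 0`, on the other through `hψ`. -/
theorem rookStep_gauge (ψ : ℕ → ℕ → ℤ[X]) (hψ : ∀ k, ψ 0 k = 0) :
    rookStep (fun h k => gauge h * ψ (h + 1) k) = fun h k => gauge h * wordStep ψ (h + 1) k := by
  funext h k
  rcases h with _ | h
  · simp [rookStep, wordStep, gauge, hψ]
  · have e : 2 * (h + 1) - 1 = h + (h + 1) := by omega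
    simp only [rookStep, wordStep, gauge, prod_range_succ, e, Nat.add_sub_cancel, pow_add]
    ring

theorem rookStep_iterate_gauge (m : ℕ) (ψ : ℕ → ℕ → ℤ[X]) (hψ : ∀ k, ψ 0 k = 0) :
    rookStep^[m] (fun h k => gauge h * ψ (h + 1) k) =
      fun h k => gauge h * wordStep^[m] ψ (h + 1) k := by
  induction m generalizing ψ with
  | zero => rfl
  | succ m ih =>
    rw [Function.iterate_succ_apply, rookStep_gauge ψ hψ, ih _ (wordStep_zero ψ)]
    rfl

/-- The indicator of `(a, c)`. -/
noncomputable def pointMass (a c : ℕ) (h k : ℕ) : ℤ[X] := if h = a ∧ k = c then 1 else 0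

/-- Level 0 is reached only from level 1, with weight 1. This absorbs the one step by which the two
paths differ in length. -/
theorem wordStep_pointMass (c : ℕ) : wordStep (pointMass 0 c) = pointMass 1 c := by
  funext b k
  rcases b with _ | _ | b <;> simp [wordStep, pointMass]

/-- Closed paths from the ground level have the same weights for the two operators. -/
theorem wordStep_iterate_eq_rookStep_iterate (m c k : ℕ) :
    wordStep^[m + 1] (pointMass 0 c) 1 k = rookStep^[m] (pointMass 0 c) 0 k := by
  -- The mass sits at `h = 0`, where the gauge is the empty product.
  have e : (pointMass 0 c) = fun h k => gauge h * pointMass 1 c (h + 1) k := by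
    funext h k
    rcases h with _ | h <;> simp [pointMass, gauge]
  rw [Function.iterate_succ_apply, wordStep_pointMass]
  conv_rhs => rw [e, rookStep_iterate_gauge m _ (by simp [pointMass])]
  simp [gauge]

/-- The ranks of the elements of `S` run through `0, …, #S - 1`. -/
theorem sum_pow_rank (S : Finset ℕ) : ∑ v ∈ S, (X : ℤ[X]) ^ #{u ∈ S | u < v} = qNum #S := by
  induction S using Finset.induction_on_max with
  | empty => simp
  | insert a S ha ih =>
    have hS : a ∉ S := fun h => lt_irrefl _ (ha a h)
    rw [sum_insert hS, card_insert_of_notMem hS, qNum, sum_range_succ, ← qNum, ← ih, add_comm]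
    congr 1
    · refine sum_congr rfl fun v hv => ?_
      rw [filter_insert, if_neg (by have := ha v hv; omega)]
    · rw [filter_insert, if_neg (lt_irrefl _), filter_true_of_mem ha]

/-! ### Partial rook placements -/

/-- The rows among `1, …, i` without a rook. -/
def openRows (i : ℕ) (R : Finset (ℕ × ℕ)) : Finset ℕ := Icc 1 i \ R.image Prod.fst

/-- The columns among `1, …, i + 1` without a rook. -/
def openCols (i : ℕ) (R : Finset (ℕ × ℕ)) : Finset ℕ := Icc 1 (i + 1) \ R.image Prod.snd

/-- `R` is a non-attacking rook placement on `[i] × [i+1]` such that a rook `(j, p+1)` with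
`j ≤ p` only occurs together with a rook `(p, v)` with `v ≤ p`. -/
structure IsPartial (i : ℕ) (R : Finset (ℕ × ℕ)) : Prop where
  row : ∀ x ∈ R, 1 ≤ x.1 ∧ x.1 ≤ i
  col : ∀ x ∈ R, 1 ≤ x.2 ∧ x.2 ≤ i + 1
  inj_row : ∀ x ∈ R, ∀ y ∈ R, x.1 = y.1 → x = y
  inj_col : ∀ x ∈ R, ∀ y ∈ R, x.2 = y.2 → x = y
  shift : ∀ x ∈ R, x.1 < x.2 → ∃ y ∈ R, y.1 + 1 = x.2 ∧ y.2 ≤ y.1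

theorem mem_openRows {i : ℕ} {R : Finset (ℕ × ℕ)} {j : ℕ} :
    j ∈ openRows i R ↔ (1 ≤ j ∧ j ≤ i) ∧ ∀ x ∈ R, x.1 ≠ j := by
  simp only [openRows, mem_sdiff, mem_Icc, mem_image, not_exists, not_and]

theorem mem_openCols {i : ℕ} {R : Finset (ℕ × ℕ)} {v : ℕ} :
    v ∈ openCols i R ↔ (1 ≤ v ∧ v ≤ i + 1) ∧ ∀ x ∈ R, x.2 ≠ v := by
  simp only [openCols, mem_sdiff, mem_Icc, mem_image, not_exists, not_and]

/-- Restriction of a placement to the board `[i] × [i+1]`. -/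
def restrictBoard (i : ℕ) (R : Finset (ℕ × ℕ)) : Finset (ℕ × ℕ) :=
  {x ∈ R | x.1 ≤ i ∧ x.2 ≤ i + 1}

namespace IsPartial

variable {i : ℕ} {R : Finset (ℕ × ℕ)}

theorem card_image_fst (h : IsPartial i R) : #(R.image Prod.fst) = #R :=
  card_image_of_injOn fun x hx y hy e => h.inj_row x hx y hy e

theorem card_image_snd (h : IsPartial i R) : #(R.image Prod.snd) = #R :=
  card_image_of_injOn fun x hx y hy e => h.inj_col x hx y hy e

theorem image_fst_subset (h : IsPartial i R) : R.image Prod.fst ⊆ Icc 1 i := by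
  intro j hj
  obtain ⟨x, hx, rfl⟩ := mem_image.1 hj
  exact mem_Icc.2 (h.row x hx)

theorem image_snd_subset (h : IsPartial i R) : R.image Prod.snd ⊆ Icc 1 (i + 1) := by
  intro j hj
  obtain ⟨x, hx, rfl⟩ := mem_image.1 hj
  exact mem_Icc.2 (h.col x hx)

theorem card_le (h : IsPartial i R) : #R ≤ i := by
  have := card_le_card h.image_fst_subset
  rwa [h.card_image_fst, Nat.card_Icc, Nat.add_sub_cancel] at this

theorem card_openRows (h : IsPartial i R) : #(openRows i R) = i - #R := by
  rw [openRows, card_sdiff_of_subset h.image_fst_subset, h.card_image_fst, Nat.card_Icc,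
    Nat.add_sub_cancel]

theorem card_openCols (h : IsPartial i R) : #(openCols i R) = i - #R + 1 := by
  rw [openCols, card_sdiff_of_subset h.image_snd_subset, h.card_image_snd, Nat.card_Icc]
  have := h.card_le
  omega

theorem succ (h : IsPartial i R) : IsPartial (i + 1) R where
  row x hx := by have := h.row x hx; omega
  col x hx := by have := h.col x hx; omega
  inj_row := h.inj_row
  inj_col := h.inj_col
  shift := h.shift

theorem insert_row (h : IsPartial i R) {v : ℕ} (hv : v ∈ openCols i R) :
    IsPartial (i + 1) (insert (i + 1, v) R) := by
  obtain ⟨⟨h1, h2⟩, h3⟩ := mem_openCols.1 hv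
  refine ⟨?_, ?_, ?_, ?_, ?_⟩
  · simp only [mem_insert, forall_eq_or_imp]
    exact ⟨by omega, fun x hx => by have := h.row x hx; omega⟩
  · simp only [mem_insert, forall_eq_or_imp]
    exact ⟨by omega, fun x hx => by have := h.col x hx; omega⟩
  · simp only [mem_insert]
    rintro x (rfl | hx) y (rfl | hy) e
    · rfl
    · have := h.row y hy; simp only at e; omega
    · have := h.row x hx; simp only at e; omega
    · exact h.inj_row x hx y hy e
  · simp only [mem_insert]
    rintro x (rfl | hx) y (rfl | hy) e
    · rfl
    · exact absurd e.symm (h3 y hy)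
    · exact absurd e (h3 x hx)
    · exact h.inj_col x hx y hy e
  · simp only [mem_insert]
    rintro x (rfl | hx) e
    · simp only at e; omega
    · obtain ⟨y, hy, hy'⟩ := h.shift x hx e
      exact ⟨y, Or.inr hy, hy'⟩

theorem insert_row_col (h : IsPartial i R) {v j : ℕ} (hv : v ∈ openCols i R)
    (hj : j ∈ openRows i R) :
    IsPartial (i + 1) (insert (j, i + 2) (insert (i + 1, v) R)) := by
  have h' := h.insert_row hv
  obtain ⟨⟨h1, h2⟩, h3⟩ := mem_openCols.1 hv
  obtain ⟨⟨k1, k2⟩, k3⟩ := mem_openRows.1 hj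
  have hc : ∀ x ∈ insert (i + 1, v) R, x.2 ≠ i + 2 := by
    simp only [mem_insert, forall_eq_or_imp]
    exact ⟨by omega, fun x hx => by have := h.col x hx; omega⟩
  have hr : ∀ x ∈ insert (i + 1, v) R, x.1 ≠ j := by
    simp only [mem_insert, forall_eq_or_imp]
    exact ⟨by omega, k3⟩
  refine ⟨?_, ?_, ?_, ?_, ?_⟩
  · intro x hx
    rcases mem_insert.1 hx with rfl | hx
    · simp only; omega
    · exact h'.row x hx
  · intro x hx
    rcases mem_insert.1 hx with rfl | hx
    · simp only; omega
    · exact h'.col x hx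
  · intro x hx y hy e
    rcases mem_insert.1 hx with rfl | hx <;> rcases mem_insert.1 hy with rfl | hy
    · rfl
    · exact absurd e.symm (hr y hy)
    · exact absurd e (hr x hx)
    · exact h'.inj_row x hx y hy e
  · intro x hx y hy e
    rcases mem_insert.1 hx with rfl | hx <;> rcases mem_insert.1 hy with rfl | hy
    · rfl
    · exact absurd e.symm (hc y hy)
    · exact absurd e (hc x hx)
    · exact h'.inj_col x hx y hy e
  · intro x hx e
    rcases mem_insert.1 hx with rfl | hx
    · exact ⟨(i + 1, v), by simp, rfl, h2⟩
    · obtain ⟨y, hy, hy'⟩ := h'.shift x hx e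
      exact ⟨y, mem_insert_of_mem hy, hy'⟩

theorem restrictBoard_self (h : IsPartial i R) : restrictBoard i R = R :=
  filter_true_of_mem fun x hx => ⟨(h.row x hx).2, (h.col x hx).2⟩

theorem restrict (h : IsPartial (i + 1) R) : IsPartial i (restrictBoard i R) where
  row x hx := by
    have hx := mem_filter.1 hx
    exact ⟨(h.row x hx.1).1, hx.2.1⟩
  col x hx := by
    have hx := mem_filter.1 hx
    exact ⟨(h.col x hx.1).1, hx.2.2⟩
  inj_row x hx y hy e := h.inj_row x (mem_filter.1 hx).1 y (mem_filter.1 hy).1 e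
  inj_col x hx y hy e := h.inj_col x (mem_filter.1 hx).1 y (mem_filter.1 hy).1 e
  shift x hx e := by
    have hx := mem_filter.1 hx
    obtain ⟨y, hy, h1, h2⟩ := h.shift x hx.1 e
    exact ⟨y, mem_filter.2 ⟨hy, by omega, by omega⟩, h1, h2⟩

/-- Only row `i + 1` and column `i + 2` are new. By `shift`, a rook in the new column forces one in
the new row, weakly left of the diagonal, so no fourth case arises. -/
theorem eq_restrict_or (h : IsPartial (i + 1) R) :
    R = restrictBoard i R ∨
      (∃ v ∈ openCols i (restrictBoard i R), R = insert (i + 1, v) (restrictBoard i R)) ∨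
      ∃ v ∈ openCols i (restrictBoard i R), ∃ j ∈ openRows i (restrictBoard i R),
        R = insert (j, i + 2) (insert (i + 1, v) (restrictBoard i R)) := by
  have hrow : ∀ x ∈ R, x.1 = i + 1 →
      x.2 ≤ i + 1 ∧ x.2 ∈ openCols i (restrictBoard i R) := by
    intro x hx e
    -- A rook at `(i + 1, i + 2)` would require, by `shift`, another rook in its own row.
    have hle : x.2 ≤ i + 1 := by
      by_contra hlt
      obtain ⟨y, hy, h1, h2⟩ := h.shift x hx (by omega)
      have := h.col x hx
      have := h.inj_row x hx y hy (by omega)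
      subst this
      omega
    refine ⟨hle, mem_openCols.2 ⟨⟨(h.col x hx).1, hle⟩, fun y hy e' => ?_⟩⟩
    have hy := mem_filter.1 hy
    have := h.inj_col x hx y hy.1 e'.symm
    subst this
    omega
  have hcol : ∀ x ∈ R, x.2 = i + 2 →
      x.1 ∈ openRows i (restrictBoard i R) ∧ ∃ v, (i + 1, v) ∈ R := by
    intro x hx e
    have hle : x.1 ≤ i := by
      by_contra hlt
      have := h.row x hx
      have := (hrow x hx (by omega)).1
      omega
    refine ⟨mem_openRows.2 ⟨⟨(h.row x hx).1, hle⟩, fun y hy e' => ?_⟩, ?_⟩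
    · have hy := mem_filter.1 hy
      have := h.inj_row x hx y hy.1 e'.symm
      subst this
      omega
    · obtain ⟨y, hy, h1, h2⟩ := h.shift x hx (by omega)
      have : y.1 = i + 1 := by omega
      exact ⟨y.2, this ▸ hy⟩
  have hcase : ∀ x ∈ R, x ∈ restrictBoard i R ∨ x.1 = i + 1 ∨ x.2 = i + 2 := by
    intro x hx
    have := h.row x hx
    have := h.col x hx
    by_cases hb : x.1 ≤ i ∧ x.2 ≤ i + 1
    · exact Or.inl (mem_filter.2 ⟨hx, hb⟩)
    · right; omega
  have hsub : restrictBoard i R ⊆ R := filter_subset _ _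
  by_cases hv : ∃ v, (i + 1, v) ∈ R
  · obtain ⟨v, hv⟩ := hv
    right
    have hvo := (hrow _ hv rfl).2
    by_cases hj : ∃ j, (j, i + 2) ∈ R
    · obtain ⟨j, hj⟩ := hj
      refine Or.inr ⟨v, hvo, j, (hcol _ hj rfl).1, ?_⟩
      ext x
      simp only [mem_insert]
      constructor
      · intro hx
        rcases hcase x hx with h1 | h1 | h1
        · exact Or.inr (Or.inr h1)
        · exact Or.inr (Or.inl (h.inj_row x hx _ hv h1))
        · exact Or.inl (h.inj_col x hx _ hj h1)
      · rintro (rfl | rfl | hx)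
        exacts [hj, hv, hsub hx]
    · refine Or.inl ⟨v, hvo, ?_⟩
      ext x
      simp only [mem_insert]
      constructor
      · intro hx
        rcases hcase x hx with h1 | h1 | h1
        · exact Or.inr h1
        · exact Or.inl (h.inj_row x hx _ hv h1)
        · exact absurd ⟨x.1, h1 ▸ hx⟩ hj
      · rintro (rfl | hx)
        exacts [hv, hsub hx]
  · left
    refine (Subset.antisymm hsub fun x hx => ?_).symm
    rcases hcase x hx with h1 | h1 | h1
    · exact h1
    · exact absurd ⟨x.2, h1 ▸ hx⟩ hv
    · exact absurd (hcol x hx h1).2 hv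

theorem restrictBoard_insert_row (h : IsPartial i R) (v : ℕ) :
    restrictBoard i (insert (i + 1, v) R) = R := by
  rw [restrictBoard, filter_insert, if_neg (by simp)]
  exact h.restrictBoard_self

theorem restrictBoard_insert_row_col (h : IsPartial i R) (v j : ℕ) :
    restrictBoard i (insert (j, i + 2) (insert (i + 1, v) R)) = R := by
  rw [restrictBoard, filter_insert, if_neg (by simp)]
  exact h.restrictBoard_insert_row v

end IsPartial

/-! ### The weight of a partial rook placement -/

/-- The number of inversions of a rook placement, as an integer. -/
def rookInv (R : Finset (ℕ × ℕ)) : ℤ :=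
  ∑ x ∈ R, ∑ y ∈ R, if x.1 < y.1 ∧ y.2 < x.2 then 1 else 0

/-- The number of excedances of a rook placement. -/
def rookExc (R : Finset (ℕ × ℕ)) : ℕ := #{x ∈ R | x.1 < x.2}

/-- The number of inversions already forced by the placement, minus its number of
excedances. -/
def rookWeight (R : Finset (ℕ × ℕ)) : ℤ :=
  rookInv R + ∑ x ∈ R, ((x.1 : ℤ) + x.2 - 2) - #R * (#R - 1) - rookExc R

theorem rookInv_insert {R : Finset (ℕ × ℕ)} {z : ℕ × ℕ} (hz : z ∉ R) :
    rookInv (insert z R) =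
      rookInv R + #{x ∈ R | x.1 < z.1 ∧ z.2 < x.2} + #{x ∈ R | z.1 < x.1 ∧ x.2 < z.2} := by
  simp only [rookInv, sum_insert hz, sum_add_distrib, lt_irrefl, false_and, if_false, zero_add,
    Finset.sum_boole]
  ring

theorem rookExc_insert {R : Finset (ℕ × ℕ)} {z : ℕ × ℕ} (hz : z ∉ R) :
    rookExc (insert z R) = rookExc R + if z.1 < z.2 then 1 else 0 := by
  unfold rookExc
  rw [filter_insert]
  split_ifs with h
  · exact card_insert_of_notMem fun hm => hz (mem_filter.1 hm).1
  · rfl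

namespace IsPartial

variable {i : ℕ} {R : Finset (ℕ × ℕ)}

theorem row_notMem (h : IsPartial i R) (v : ℕ) : (i + 1, v) ∉ R := fun hm => by
  have := h.row _ hm
  simp only at this
  omega

theorem col_notMem (h : IsPartial i R) {v : ℕ} (hv : v ∈ openCols i R) (j : ℕ) :
    (j, i + 2) ∉ insert (i + 1, v) R := by
  have hv := (mem_openCols.1 hv).1
  rw [mem_insert, Prod.mk.injEq]
  rintro (⟨-, h2⟩ | hm)
  · omega
  · have := h.col _ hm
    simp only at this
    omega

/-- The `i + 1 - v` columns beyond `v` are occupied or open. As there are `i - #R + 1` open columns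
including `v`, those beyond `v` number `i - #R` minus those before `v`. -/
theorem card_filter_col (h : IsPartial i R) {v : ℕ} (hv : v ∈ openCols i R) :
    #{x ∈ R | v < x.2} + (i - #R) = i + 1 - v + #{u ∈ openCols i R | u < v} := by
  have hv' := mem_openCols.1 hv
  have e1 : #{x ∈ R | v < x.2} = #{u ∈ R.image Prod.snd | v < u} := by
    rw [filter_image]
    exact (card_image_of_injOn fun x hx y hy e =>
      h.inj_col x (mem_filter.1 hx).1 y (mem_filter.1 hy).1 e).symm
  have e2 : #{u ∈ openCols i R | v < u} + #{u ∈ R.image Prod.snd | v < u} = i + 1 - v := by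
    rw [← card_union_of_disjoint, ← filter_union, openCols,
      sdiff_union_of_subset h.image_snd_subset]
    · rw [show ({u ∈ Icc 1 (i + 1) | v < u}) = Icc (v + 1) (i + 1) by
        ext u; simp only [mem_filter, mem_Icc]; omega, Nat.card_Icc]
      omega
    · exact disjoint_filter_filter sdiff_disjoint
  have e3 : #{u ∈ openCols i R | u < v} + (1 + #{u ∈ openCols i R | v < u}) = i - #R + 1 := by
    rw [← h.card_openCols, ← card_filter_add_card_filter_not (s := openCols i R) (· < v)]
    congr 1
    rw [show ({u ∈ openCols i R | ¬u < v}) = insert v {u ∈ openCols i R | v < u} by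
      ext u
      simp only [mem_filter, mem_insert]
      constructor
      · rintro ⟨h1, h2⟩
        rcases eq_or_ne u v with rfl | hne
        · exact Or.inl rfl
        · exact Or.inr ⟨h1, by omega⟩
      · rintro (rfl | ⟨h1, h2⟩)
        · exact ⟨hv, by omega⟩
        · exact ⟨h1, by omega⟩]
    rw [card_insert_of_notMem (by simp), add_comm]
  omega

theorem card_filter_row (h : IsPartial i R) {j : ℕ} (hj : j ∈ openRows i R) :
    #{x ∈ R | j < x.1} + (i - #R) = i + 1 - j + #{u ∈ openRows i R | u < j} := by
  have hj' := mem_openRows.1 hj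
  have e1 : #{x ∈ R | j < x.1} = #{u ∈ R.image Prod.fst | j < u} := by
    rw [filter_image]
    exact (card_image_of_injOn fun x hx y hy e =>
      h.inj_row x (mem_filter.1 hx).1 y (mem_filter.1 hy).1 e).symm
  have e2 : #{u ∈ openRows i R | j < u} + #{u ∈ R.image Prod.fst | j < u} = i - j := by
    rw [← card_union_of_disjoint, ← filter_union, openRows,
      sdiff_union_of_subset h.image_fst_subset]
    · rw [show ({u ∈ Icc 1 i | j < u}) = Icc (j + 1) i by
        ext u; simp only [mem_filter, mem_Icc]; omega, Nat.card_Icc]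
      omega
    · exact disjoint_filter_filter sdiff_disjoint
  have e3 : #{u ∈ openRows i R | u < j} + (1 + #{u ∈ openRows i R | j < u}) = i - #R := by
    rw [← h.card_openRows, ← card_filter_add_card_filter_not (s := openRows i R) (· < j)]
    congr 1
    rw [show ({u ∈ openRows i R | ¬u < j}) = insert j {u ∈ openRows i R | j < u} by
      ext u
      simp only [mem_filter, mem_insert]
      constructor
      · rintro ⟨h1, h2⟩
        rcases eq_or_ne u j with rfl | hne
        · exact Or.inl rfl
        · exact Or.inr ⟨h1, by omega⟩
      · rintro (rfl | ⟨h1, h2⟩)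
        · exact ⟨hj, by omega⟩
        · exact ⟨h1, by omega⟩]
    rw [card_insert_of_notMem (by simp), add_comm]
  omega

/-- In `rookWeight`, the sum of `x.1 + x.2 - 2` minus `#R * (#R - 1)` counts, for each rook, the
open rows above it and the open columns to its left. Each is an inversion in any completion: open
rows end beyond column `i + 1`, open columns are filled from rows beyond `i`. The new rook has all
`i - #R` open rows above it and the open columns before `v` to its left. -/
theorem rookWeight_insert_row (h : IsPartial i R) {v : ℕ} (hv : v ∈ openCols i R) :
    rookWeight (insert (i + 1, v) R) =
      rookWeight R + ((i - #R + #{u ∈ openCols i R | u < v} : ℕ) : ℤ) := by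
  have hz := h.row_notMem v
  have hv' := (mem_openCols.1 hv).1
  have c := h.card_filter_col hv
  have hle := h.card_le
  have f1 : ({x ∈ R | x.1 < i + 1 ∧ v < x.2}) = {x ∈ R | v < x.2} :=
    filter_congr fun x hx => by have := h.row x hx; omega
  have f2 : ({x ∈ R | i + 1 < x.1 ∧ x.2 < v}) = ∅ :=
    filter_false_of_mem fun x hx => by have := h.row x hx; omega
  rw [rookWeight, rookInv_insert hz, rookExc_insert hz, sum_insert hz, card_insert_of_notMem hz,
    if_neg (by simp only; omega), f1, f2, rookWeight]
  have c' : (#{x ∈ R | v < x.2} : ℤ) + (i - #R) = i + 1 - v + #{u ∈ openCols i R | u < v} := by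
    omega
  push_cast [Nat.cast_sub hle]
  rw [card_empty]
  linear_combination c'

/-- After the rook in row `i + 1`, there remain `i - #R` open old columns, all left of `i + 2`. The
second rook adds these and the open rows above `j`, minus 1 for being an excedance. Its inversions
with rooks below row `j`, apart from the one just placed, were counted while row `j` was open. -/
theorem rookWeight_insert_row_col (h : IsPartial i R) {v j : ℕ} (hv : v ∈ openCols i R)
    (hj : j ∈ openRows i R) :
    rookWeight (insert (j, i + 2) (insert (i + 1, v) R)) =
      rookWeight R + ((i - #R + #{u ∈ openCols i R | u < v} +
        (i - #R - 1 + #{u ∈ openRows i R | u < j}) : ℕ) : ℤ) := by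
  have h' := h.insert_row hv
  have hz := h.col_notMem hv j
  have hz' := h.row_notMem v
  have hv' := (mem_openCols.1 hv).1
  have hj' := (mem_openRows.1 hj).1
  have c := h.card_filter_row hj
  have hle := h.card_le
  have hlt : 0 < i - #R := by rw [← h.card_openRows]; exact card_pos.2 ⟨j, hj⟩
  have f1 : ({x ∈ insert (i + 1, v) R | x.1 < j ∧ i + 2 < x.2}) = ∅ :=
    filter_false_of_mem fun x hx => by have := h'.col x hx; omega
  have f2 : ({x ∈ insert (i + 1, v) R | j < x.1 ∧ x.2 < i + 2}) =
      insert (i + 1, v) {x ∈ R | j < x.1} := by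
    rw [filter_insert, if_pos (by simp only; omega)]
    congr 1
    exact filter_congr fun x hx => by have := h.col x hx; omega
  rw [rookWeight, rookInv_insert hz, rookExc_insert hz, sum_insert hz, card_insert_of_notMem hz,
    if_pos (by simp only; omega), f1, f2, card_insert_of_notMem fun hm => hz' (mem_filter.1 hm).1,
    card_insert_of_notMem hz', card_empty]
  have e := h.rookWeight_insert_row hv
  rw [rookWeight, card_insert_of_notMem hz'] at e
  have c' : (#{x ∈ R | j < x.1} : ℤ) + (i - #R) = i + 1 - j + #{u ∈ openRows i R | u < j} := by
    omega
  push_cast [Nat.cast_sub hle, Nat.cast_sub (show 1 ≤ i - #R from hlt)] at e ⊢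
  linear_combination c' + e

end IsPartial

/-! ### Generating function of partial placements: one more row and column -/

open Classical in
/-- The partial rook placements on `[i] × [i+1]`. -/
noncomputable def partialRooks (i : ℕ) : Finset (Finset (ℕ × ℕ)) :=
  (Icc 1 i ×ˢ Icc 1 (i + 1)).powerset.filter (IsPartial i)

open Classical in
theorem mem_partialRooks {i : ℕ} {R : Finset (ℕ × ℕ)} : R ∈ partialRooks i ↔ IsPartial i R := by
  rw [partialRooks, mem_filter, mem_powerset, and_iff_right_iff_imp]
  exact fun h x hx => mem_product.2 ⟨mem_Icc.2 (h.row x hx), mem_Icc.2 (h.col x hx)⟩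

theorem partialRooks_zero : partialRooks 0 = {∅} := by
  ext R
  rw [mem_partialRooks, mem_singleton]
  constructor
  · intro h
    exact card_eq_zero.1 (Nat.le_zero.1 h.card_le)
  · rintro rfl
    constructor <;> simp

theorem partialRooks_fiber {i : ℕ} {R : Finset (ℕ × ℕ)} (h : IsPartial i R) :
    {R' ∈ partialRooks (i + 1) | restrictBoard i R' = R} =
      {R} ∪ ((openCols i R).image (fun v => insert (i + 1, v) R) ∪
        (openCols i R ×ˢ openRows i R).image
          fun p => insert (p.2, i + 2) (insert (i + 1, p.1) R)) := by
  ext R'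
  simp only [mem_filter, mem_partialRooks, mem_union, mem_singleton, mem_image, mem_product,
    Prod.exists]
  constructor
  · rintro ⟨h', rfl⟩
    rcases h'.eq_restrict_or with e | ⟨v, hv, e⟩ | ⟨v, hv, j, hj, e⟩
    · exact Or.inl e
    · exact Or.inr (Or.inl ⟨v, hv, e.symm⟩)
    · exact Or.inr (Or.inr ⟨v, j, ⟨hv, hj⟩, e.symm⟩)
  · rintro (rfl | ⟨v, hv, rfl⟩ | ⟨v, j, ⟨hv, hj⟩, rfl⟩)
    · exact ⟨h.succ, h.restrictBoard_self⟩
    · exact ⟨h.insert_row hv, h.restrictBoard_insert_row v⟩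
    · exact ⟨h.insert_row_col hv hj, h.restrictBoard_insert_row_col v j⟩

/-- Group the placements by their restriction to the smaller board. The three kinds of extension are
disjoint because they have `#R`, `#R + 1` and `#R + 2` rooks. -/
theorem sum_partialRooks_succ {M : Type*} [AddCommMonoid M] (i : ℕ)
    (g : Finset (ℕ × ℕ) → M) :
    ∑ R ∈ partialRooks (i + 1), g R = ∑ R ∈ partialRooks i,
      (g R + (∑ v ∈ openCols i R, g (insert (i + 1, v) R) +
        ∑ v ∈ openCols i R, ∑ j ∈ openRows i R,
          g (insert (j, i + 2) (insert (i + 1, v) R)))) := by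
  rw [← sum_fiberwise_of_maps_to (s := partialRooks (i + 1)) (t := partialRooks i)
    (g := restrictBoard i) fun R hR => mem_partialRooks.2 (mem_partialRooks.1 hR).restrict]
  refine sum_congr rfl fun R hR => ?_
  have h := mem_partialRooks.1 hR
  have c1 : ∀ v, #(insert (i + 1, v) R) = #R + 1 := fun v => card_insert_of_notMem (h.row_notMem v)
  have c2 : ∀ v ∈ openCols i R, ∀ j, #(insert (j, i + 2) (insert (i + 1, v) R)) = #R + 2 :=
    fun v hv j => by rw [card_insert_of_notMem (h.col_notMem hv j), c1]
  rw [partialRooks_fiber h, sum_union, sum_singleton, sum_union, sum_image, sum_image, sum_product]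
  · rintro ⟨v, j⟩ hp ⟨v', j'⟩ hp' e
    simp only [coe_product, Set.mem_prod, mem_coe] at hp hp' e
    have h1 : (i + 1, v) ∈ insert (j', i + 2) (insert (i + 1, v') R) :=
      e ▸ mem_insert_of_mem (mem_insert_self _ _)
    have h2 : (j, i + 2) ∈ insert (j', i + 2) (insert (i + 1, v') R) :=
      e ▸ mem_insert_self _ _
    have hv := (mem_openCols.1 hp.1).1
    have hj : j = j' := by
      rcases mem_insert.1 h2 with h2 | h2
      · exact (Prod.mk.inj h2).1
      · exact absurd h2 (h.col_notMem hp'.1 j)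
    have hv' : v = v' := by
      rcases mem_insert.1 h1 with h1 | h1
      · have := (Prod.mk.inj h1).2
        omega
      · rcases mem_insert.1 h1 with h1 | h1
        · exact (Prod.mk.inj h1).2
        · exact absurd h1 (h.row_notMem v)
    rw [hj, hv']
  · intro v hv v' hv' e
    have h1 : (i + 1, v) ∈ insert (i + 1, v') R := by
      simp only at e
      rw [← e]; simp
    rcases mem_insert.1 h1 with h1 | h1
    · exact (Prod.mk.inj h1).2
    · exact absurd h1 (h.row_notMem v)
  · refine disjoint_left.2 fun S hS hS' => ?_
    obtain ⟨v, hv, rfl⟩ := mem_image.1 hS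
    obtain ⟨p, hp, e⟩ := mem_image.1 hS'
    have := congrArg card e
    rw [c1, c2 _ (mem_product.1 hp).1] at this
    omega
  · refine disjoint_left.2 fun S hS hS' => ?_
    obtain rfl := mem_singleton.1 hS
    rcases mem_union.1 hS' with hS' | hS'
    · obtain ⟨v, hv, e⟩ := mem_image.1 hS'
      have := congrArg card e
      rw [c1] at this
      omega
    · obtain ⟨p, hp, e⟩ := mem_image.1 hS'
      have := congrArg card e
      rw [c2 _ (mem_product.1 hp).1] at this
      omega

/-- No extension lowers the weight; hence `toNat` loses nothing in `rookSum`. -/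
theorem rookWeight_nonneg {i : ℕ} {R : Finset (ℕ × ℕ)} (h : IsPartial i R) :
    0 ≤ rookWeight R := by
  induction i generalizing R with
  | zero =>
    have : R = ∅ := card_eq_zero.1 (Nat.le_zero.1 h.card_le)
    subst this
    simp [rookWeight, rookInv, rookExc]
  | succ i ih =>
    have hr := ih h.restrict
    rcases h.eq_restrict_or with e | ⟨v, hv, e⟩ | ⟨v, hv, j, hj, e⟩ <;> rw [e]
    · exact hr
    · rw [h.restrict.rookWeight_insert_row hv]; exact add_nonneg hr (Nat.cast_nonneg _)
    · rw [h.restrict.rookWeight_insert_row_col hv hj]; exact add_nonneg hr (Nat.cast_nonneg _)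

/-- The generating function of partial rook placements tested against a function `φ` of the
number of open rows and of the number of excedances, open rows included. -/
noncomputable def rookSum (i : ℕ) (φ : ℕ → ℕ → ℤ[X]) : ℤ[X] :=
  ∑ R ∈ partialRooks i, X ^ (rookWeight R).toNat * φ (i - #R) (i - #R + rookExc R + 1)

theorem rookSum_zero (φ : ℕ → ℕ → ℤ[X]) : rookSum 0 φ = φ 0 1 := by
  simp [rookSum, partialRooks_zero, rookWeight, rookInv, rookExc]

/-- The three extensions give the three terms of `rookStep`, the ranks of `v` and `j` summing to
`q`-numbers. The second index grows only when row `i + 1` stays open: filling column `i + 2` merely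
trades an open row for an excedance. -/
theorem rookSum_succ (i : ℕ) (φ : ℕ → ℕ → ℤ[X]) : rookSum (i + 1) φ = rookSum i (rookStep φ) := by
  rw [rookSum, sum_partialRooks_succ]
  refine sum_congr rfl fun R hR => ?_
  have h := mem_partialRooks.1 hR
  have hle := h.card_le
  have hw := rookWeight_nonneg h
  have s1 : ∀ v ∈ openCols i R,
      X ^ (rookWeight (insert (i + 1, v) R)).toNat *
        φ (i + 1 - #(insert (i + 1, v) R))
          (i + 1 - #(insert (i + 1, v) R) + rookExc (insert (i + 1, v) R) + 1) =
      X ^ #{u ∈ openCols i R | u < v} * (X ^ (rookWeight R).toNat * X ^ (i - #R) *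
        φ (i - #R) (i - #R + rookExc R + 1)) := by
    intro v hv
    have hv' := (mem_openCols.1 hv).1
    rw [h.rookWeight_insert_row hv, Int.toNat_add hw (Nat.cast_nonneg _), Int.toNat_natCast,
      card_insert_of_notMem (h.row_notMem v), rookExc_insert (h.row_notMem v),
      if_neg (by simp only; omega), Nat.add_sub_add_right, pow_add, pow_add]
    ring_nf
  have s2 : ∀ v ∈ openCols i R, ∀ j ∈ openRows i R,
      X ^ (rookWeight (insert (j, i + 2) (insert (i + 1, v) R))).toNat *
        φ (i + 1 - #(insert (j, i + 2) (insert (i + 1, v) R)))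
          (i + 1 - #(insert (j, i + 2) (insert (i + 1, v) R)) +
            rookExc (insert (j, i + 2) (insert (i + 1, v) R)) + 1) =
      X ^ #{u ∈ openCols i R | u < v} * (X ^ #{u ∈ openRows i R | u < j} *
        (X ^ (rookWeight R).toNat * X ^ (2 * (i - #R) - 1) *
          φ (i - #R - 1) (i - #R + rookExc R + 1))) := by
    intro v hv j hj
    have hv' := (mem_openCols.1 hv).1
    have hj' := (mem_openRows.1 hj).1
    have hlt : 0 < i - #R := by rw [← h.card_openRows]; exact card_pos.2 ⟨j, hj⟩
    have e1 : i + 1 - (#R + 1 + 1) = i - #R - 1 := by omega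
    have e2 : i - #R - 1 + (rookExc R + 0 + 1) + 1 = i - #R + rookExc R + 1 := by omega
    have e3 : 2 * (i - #R) - 1 = (i - #R) + (i - #R - 1) := by omega
    rw [h.rookWeight_insert_row_col hv hj, Int.toNat_add hw (Nat.cast_nonneg _), Int.toNat_natCast,
      card_insert_of_notMem (h.col_notMem hv j), card_insert_of_notMem (h.row_notMem v),
      rookExc_insert (h.col_notMem hv j), rookExc_insert (h.row_notMem v),
      if_neg (by simp only; omega), if_pos (by simp only; omega), e1, e2, e3]
    simp only [pow_add]
    ring
  rw [sum_congr rfl s1, sum_congr rfl fun v hv => sum_congr rfl (s2 v hv)]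
  simp only [← mul_sum, ← sum_mul]
  rw [sum_pow_rank, sum_pow_rank, h.card_openCols, h.card_openRows, rookStep,
    show i + 1 - #R = i - #R + 1 by omega,
    show i - #R + 1 + rookExc R + 1 = i - #R + rookExc R + 1 + 1 by omega]
  ring

theorem rookSum_eq (i : ℕ) (φ : ℕ → ℕ → ℤ[X]) : rookSum i φ = rookStep^[i] φ 0 1 := by
  induction i generalizing φ with
  | zero => exact rookSum_zero φ
  | succ i ih => rw [rookSum_succ, ih, Function.iterate_succ_apply]

/-! ### One-line words -/

section Word

variable {n : ℕ} (σ : Equiv.Perm (Fin n))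

theorem word_succ {i : ℕ} (hi : i < n) : word σ (i + 1) = (σ ⟨i, hi⟩ : ℕ) + 1 := by
  have : i + 1 ≤ n := hi
  simp [word, this]

theorem word_zero : word σ 0 = 0 := by simp [word]

theorem word_of_lt {i : ℕ} (hi : n < i) : word σ i = 0 := by
  rw [word, dif_neg (by omega)]

theorem word_mem {i : ℕ} (hi : i ∈ Icc 1 n) : word σ i ∈ Icc 1 n := by
  rw [mem_Icc] at hi
  obtain ⟨j, rfl⟩ : ∃ j, i = j + 1 := ⟨i - 1, by omega⟩
  rw [word_succ σ hi.2, mem_Icc]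
  have := (σ ⟨j, hi.2⟩).isLt
  omega

theorem word_inv_word {i : ℕ} (hi : i ∈ Icc 1 n) : word σ⁻¹ (word σ i) = i := by
  rw [mem_Icc] at hi
  obtain ⟨j, rfl⟩ : ∃ j, i = j + 1 := ⟨i - 1, by omega⟩
  rw [word_succ σ hi.2, word_succ σ⁻¹ (σ ⟨j, hi.2⟩).isLt]
  simp

theorem word_word_inv {i : ℕ} (hi : i ∈ Icc 1 n) : word σ (word σ⁻¹ i) = i := by
  simpa using word_inv_word σ⁻¹ hi

theorem word_injOn : Set.InjOn (word σ) (Icc 1 n) := fun i hi j hj e => by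
  rw [← word_inv_word σ hi, e, word_inv_word σ hj]

theorem image_word : (Icc 1 n).image (word σ) = Icc 1 n := by
  refine eq_of_subset_of_card_le ?_ (card_image_of_injOn (word_injOn σ)).ge
  intro v hv
  obtain ⟨i, hi, rfl⟩ := mem_image.1 hv
  exact word_mem σ hi

theorem sum_word {M : Type*} [AddCommMonoid M] (g : ℕ → M) :
    ∑ i ∈ Icc 1 n, g (word σ i) = ∑ i ∈ Icc 1 n, g i := by
  conv_rhs => rw [← image_word σ, sum_image (word_injOn σ)]

theorem word_injective : Function.Injective (word : Equiv.Perm (Fin n) → ℕ → ℕ) := by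
  intro σ τ e
  ext i
  have := congrFun e (i + 1)
  rw [word_succ σ i.isLt, word_succ τ i.isLt] at this
  exact Nat.add_right_cancel this

theorem scda_eq_zero_iff : scda σ = 0 ↔
    ∀ i ∈ Icc 1 (n - 1), i < word σ i → i < word σ⁻¹ (i + 1) := by
  rw [scda, card_eq_zero, filter_eq_empty_iff]
  refine forall₂_congr fun i hi => ?_
  have hi := mem_Icc.1 hi
  constructor
  · intro h h1
    by_contra h2
    exact h ⟨h1, by omega⟩
  · rintro h ⟨h1, h2⟩
    have := h h1
    have e : word σ⁻¹ (i + 1) ≠ i + 1 := by omega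
    omega

/-! ### The star companion and shifted double excedances -/

theorem star_inv_eq (i : Fin (n + 1)) (hi : (i : ℕ) < n) :
    ((star σ)⁻¹ i : ℕ) = word σ⁻¹ (i + 1) := by
  obtain ⟨j, rfl⟩ : ∃ j : Fin n, i = j.castSucc := ⟨⟨i, hi⟩, rfl⟩
  rw [Fin.val_castSucc, word_succ σ⁻¹ j.isLt]
  change ((Fin.lastCases 0 (fun i => (σ.symm i).succ) j.castSucc : Fin (n + 1)) : ℕ) = _
  rw [Fin.lastCases_castSucc]
  rfl

/-- A shifted double excedance means `σ⁻¹(i+1) ≤ i ≤ σ(i) - 1`, that is, `(σ*)⁻¹(i) ≤ i ≤ σ*(i)`.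
Equality holds on both sides or on neither, which separates the fixed points from the strict case.
-/
theorem cdaStar_add_fixStar_eq_zero_iff : cdaStar σ + fixStar σ = 0 ↔ scda σ = 0 := by
  rw [Nat.add_eq_zero_iff, cdaStar, fixStar, scda_eq_zero_iff, card_eq_zero, card_eq_zero,
    filter_eq_empty_iff, filter_eq_empty_iff]
  have key : ∀ i : Fin (n + 1), 1 ≤ (i : ℕ) → (i : ℕ) ≤ n - 1 →
      (((star σ)⁻¹ i < i ∧ i < star σ i) ↔ word σ⁻¹ (i + 1) < i ∧ (i : ℕ) + 1 < word σ i) ∧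
      (i = star σ i ↔ word σ i = i + 1) ∧ (word σ i = i + 1 ↔ word σ⁻¹ (i + 1) = i) := by
    intro i h1 h2
    have hi : (i : ℕ) ∈ Icc 1 n := mem_Icc.2 ⟨h1, by omega⟩
    have hi' : (i : ℕ) + 1 ∈ Icc 1 n := mem_Icc.2 ⟨by omega, by omega⟩
    have e1 := star_eq σ i (by rintro rfl; simp at h1)
    have e2 := star_inv_eq σ i (by omega)
    have := mem_Icc.1 (word_mem σ hi)
    refine ⟨?_, ?_, ?_⟩
    · rw [Fin.lt_def, Fin.lt_def, e1, e2]; omega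
    · rw [Fin.ext_iff, e1]; omega
    · exact ⟨fun h => by rw [← h, word_inv_word σ hi], fun h => by
        have := word_word_inv σ hi'; rwa [h] at this⟩
  constructor
  · rintro ⟨ha, hb⟩ i hi h
    have hi := mem_Icc.1 hi
    have k := key ⟨i, by omega⟩ hi.1 hi.2
    have ha := @ha ⟨i, by omega⟩ (mem_univ _)
    have hb := @hb ⟨i, by omega⟩ (mem_univ _)
    simp only at k ha hb
    by_contra hc
    rcases eq_or_ne (word σ i) (i + 1) with e | e
    · exact hb ⟨hi, k.2.1.2 e⟩
    · have := mt k.2.2.2 e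
      exact ha ⟨hi, k.1.2 ⟨by omega, by omega⟩⟩
  · intro h
    refine ⟨fun i _ hc => ?_, fun i _ hc => ?_⟩
    · have k := key i hc.1.1 hc.1.2
      have := k.1.1 hc.2
      have := h i (mem_Icc.2 hc.1) (by omega)
      omega
    · have k := key i hc.1.1 hc.1.2
      have e := k.2.1.1 hc.2
      have := k.2.2.1 e
      have := h i (mem_Icc.2 hc.1) (by omega)
      omega

theorem DEStar_eq_SDE (n k : ℕ) : DEStar n k = SDE n k := by
  ext σ
  simp only [DEStar, SDE, mem_filter, cdaStar_add_fixStar_eq_zero_iff]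

end Word

/-! ### Permutations as full rook placements -/

/-- The rooks `(p, σ p)` with `1 ≤ p ≤ m`. -/
def graphOn {n : ℕ} (m : ℕ) (σ : Equiv.Perm (Fin n)) : Finset (ℕ × ℕ) :=
  (Icc 1 m).image fun p => (p, word σ p)

theorem mem_graphOn {n m : ℕ} {σ : Equiv.Perm (Fin n)} {x : ℕ × ℕ} :
    x ∈ graphOn m σ ↔ (1 ≤ x.1 ∧ x.1 ≤ m) ∧ x.2 = word σ x.1 := by
  rw [graphOn, mem_image]
  constructor
  · rintro ⟨p, hp, rfl⟩
    exact ⟨mem_Icc.1 hp, rfl⟩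
  · rintro ⟨h1, h2⟩
    exact ⟨x.1, mem_Icc.2 h1, Prod.ext rfl h2.symm⟩

theorem card_graphOn {n : ℕ} (m : ℕ) (σ : Equiv.Perm (Fin n)) : #(graphOn m σ) = m := by
  rw [graphOn, card_image_of_injective _ fun a b e => (Prod.mk.inj e).1, Nat.card_Icc,
    Nat.add_sub_cancel]

theorem sum_graphOn {n : ℕ} (m : ℕ) (σ : Equiv.Perm (Fin n)) {M : Type*} [AddCommMonoid M]
    (g : ℕ × ℕ → M) : ∑ x ∈ graphOn m σ, g x = ∑ p ∈ Icc 1 m, g (p, word σ p) := by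
  rw [graphOn, sum_image fun a _ b _ e => (Prod.mk.inj e).1]

theorem sum_two_mul_sub_two (n : ℕ) : ∑ p ∈ Icc 1 n, (2 * (p : ℤ) - 2) = n * (n - 1) := by
  induction n with
  | zero => simp
  | succ n ih =>
    rw [sum_Icc_succ_top (by omega), ih]
    push_cast
    ring

theorem rookExc_graphOn {n : ℕ} (m : ℕ) (σ : Equiv.Perm (Fin n)) :
    rookExc (graphOn m σ) = #{p ∈ Icc 1 m | p < word σ p} := by
  rw [rookExc, card_filter, sum_graphOn, card_filter]

theorem rookWeight_graphOn {n : ℕ} (σ : Equiv.Perm (Fin n)) :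
    rookWeight (graphOn n σ) = inv σ - exc σ := by
  have e1 : rookInv (graphOn n σ) = inv σ := by
    rw [rookInv, inv, card_filter, sum_product, sum_graphOn]
    push_cast
    exact sum_congr rfl fun p _ => sum_graphOn n σ _
  -- With every row and column occupied no inversion is pending, so the correction terms cancel.
  have e2 : ∑ x ∈ graphOn n σ, ((x.1 : ℤ) + x.2 - 2) = n * (n - 1) := by
    rw [← sum_two_mul_sub_two n, sum_graphOn]
    simp only [sum_sub_distrib, sum_add_distrib, two_mul]
    rw [sum_word σ fun p => (p : ℤ)]
  rw [rookWeight, e1, e2, card_graphOn, rookExc_graphOn, ← exc]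
  ring

theorem graphOn_succ {n : ℕ} (m : ℕ) (σ : Equiv.Perm (Fin n)) :
    graphOn (m + 1) σ = insert (m + 1, word σ (m + 1)) (graphOn m σ) := by
  rw [graphOn, graphOn, ← insert_Icc_right_eq_Icc_add_one (by omega), image_insert]

section Full

variable {m : ℕ} (σ : Equiv.Perm (Fin (m + 1)))

/-- The last row is left out, so that the board is `[m] × [m+1]`; `shift` at a rook in column `u +
1` is the condition `scda σ = 0` at `u`. -/
theorem isPartial_graphOn (h : scda σ = 0) : IsPartial m (graphOn m σ) := by
  have hI : ∀ p, 1 ≤ p ∧ p ≤ m → p ∈ Icc 1 (m + 1) := fun p hp => mem_Icc.2 (by omega)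
  refine ⟨fun x hx => (mem_graphOn.1 hx).1, fun x hx => ?_, fun x hx y hy e => ?_,
    fun x hx y hy e => ?_, fun x hx e => ?_⟩
  · obtain ⟨h1, h2⟩ := mem_graphOn.1 hx
    rw [h2]
    exact mem_Icc.1 (word_mem σ (hI _ h1))
  · obtain ⟨h1, h2⟩ := mem_graphOn.1 hx
    obtain ⟨k1, k2⟩ := mem_graphOn.1 hy
    exact Prod.ext e (by rw [h2, k2, e])
  · obtain ⟨h1, h2⟩ := mem_graphOn.1 hx
    obtain ⟨k1, k2⟩ := mem_graphOn.1 hy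
    exact Prod.ext (word_injOn σ (hI _ h1) (hI _ k1) (by rw [← h2, ← k2, e])) e
  · obtain ⟨h1, h2⟩ := mem_graphOn.1 hx
    have h3 := mem_Icc.1 (word_mem σ (hI _ h1))
    obtain ⟨u, hu⟩ : ∃ u, x.2 = u + 1 := ⟨x.2 - 1, by omega⟩
    have hu' : 1 ≤ u ∧ u ≤ m := by omega
    refine ⟨(u, word σ u), mem_graphOn.2 ⟨hu', rfl⟩, hu.symm, ?_⟩
    by_contra hlt
    have := (scda_eq_zero_iff σ).1 h u (mem_Icc.2 hu') (not_le.1 hlt)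
    rw [← hu, h2, word_inv_word σ (hI _ h1)] at this
    omega

theorem word_last_mem_openCols : word σ (m + 1) ∈ openCols m (graphOn m σ) := by
  have hl : m + 1 ∈ Icc 1 (m + 1) := mem_Icc.2 (by omega)
  refine mem_openCols.2 ⟨mem_Icc.1 (word_mem σ hl), fun x hx e => ?_⟩
  obtain ⟨h1, h2⟩ := mem_graphOn.1 hx
  have := word_injOn σ (mem_Icc.2 (by omega) : x.1 ∈ Icc 1 (m + 1)) hl (by rw [← h2, e])
  omega

/-- The last rook meets no open row and takes the only open column, so it adds nothing. -/
theorem rookWeight_graphOn_pred (h : scda σ = 0) :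
    rookWeight (graphOn m σ) = inv σ - exc σ := by
  have hp := isPartial_graphOn σ h
  have hl := word_last_mem_openCols σ
  rw [← rookWeight_graphOn, graphOn_succ, hp.rookWeight_insert_row hl, card_graphOn]
  have c : #(openCols m (graphOn m σ)) = 1 := by
    rw [hp.card_openCols, card_graphOn, Nat.sub_self]
  obtain ⟨a, ha⟩ := card_eq_one.1 c
  rw [ha, mem_singleton] at hl
  simp [ha, hl]

theorem rookExc_graphOn_pred : rookExc (graphOn m σ) = exc σ := by
  have hl : m + 1 ∈ Icc 1 (m + 1) := mem_Icc.2 (by omega)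
  have := mem_Icc.1 (word_mem σ hl)
  rw [rookExc_graphOn, exc, ← insert_Icc_right_eq_Icc_add_one (by omega), filter_insert,
    if_neg (by omega)]

/-- The omitted last value is recovered from the sum of all values. -/
theorem graphOn_injective :
    Function.Injective (graphOn m : Equiv.Perm (Fin (m + 1)) → Finset (ℕ × ℕ)) := by
  intro σ τ e
  have h : ∀ p ∈ Icc 1 m, word σ p = word τ p := by
    intro p hp
    have : (p, word σ p) ∈ graphOn m τ := e ▸ mem_graphOn.2 ⟨mem_Icc.1 hp, rfl⟩
    exact (mem_graphOn.1 this).2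
  refine word_injective (funext fun p => ?_)
  have hs := (sum_word σ fun p => p).trans (sum_word τ fun p => p).symm
  rw [sum_Icc_succ_top (by omega), sum_Icc_succ_top (by omega), sum_congr rfl h] at hs
  rcases Nat.eq_zero_or_pos p with rfl | h0
  · rw [word_zero, word_zero]
  rcases lt_trichotomy p (m + 1) with h1 | rfl | h1
  · exact h p (mem_Icc.2 (by omega))
  · exact Nat.add_left_cancel hs
  · rw [word_of_lt σ h1, word_of_lt τ h1]

theorem exists_graphOn_eq {R : Finset (ℕ × ℕ)} (h : IsPartial m R) (hR : #R = m) :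
    ∃ σ : Equiv.Perm (Fin (m + 1)), scda σ = 0 ∧ graphOn m σ = R := by
  obtain ⟨v, hv⟩ : (openCols m R).Nonempty := by
    rw [← card_pos, h.card_openCols]; omega
  have h' := h.insert_row hv
  set S := insert (m + 1, v) R with hS
  have hcS : #S = m + 1 := by rw [hS, card_insert_of_notMem (h.row_notMem v), hR]
  have hfst : S.image Prod.fst = Icc 1 (m + 1) :=
    eq_of_subset_of_card_le h'.image_fst_subset (by
      rw [h'.card_image_fst, hcS, Nat.card_Icc, Nat.add_sub_cancel])
  have hcol : ∀ x ∈ S, 1 ≤ x.2 ∧ x.2 ≤ m + 1 := by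
    intro x hx
    rcases mem_insert.1 hx with rfl | hx
    · exact (mem_openCols.1 hv).1
    · exact h.col x hx
  have hex : ∀ i : Fin (m + 1), ∃ u : Fin (m + 1), ((i : ℕ) + 1, (u : ℕ) + 1) ∈ S := by
    intro i
    have : (i : ℕ) + 1 ∈ S.image Prod.fst := by
      rw [hfst, mem_Icc]; omega
    obtain ⟨x, hx, e⟩ := mem_image.1 this
    have hc := hcol x hx
    refine ⟨⟨x.2 - 1, by omega⟩, ?_⟩
    rw [← e]
    simpa only [Nat.sub_add_cancel hc.1] using hx
  choose f hf using hex
  have hinj : Function.Injective f := by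
    intro i j e
    have := h'.inj_col _ (hf i) _ (hf j) (by simp only [e])
    have := (Prod.mk.inj this).1
    exact Fin.ext (by omega)
  let σ : Equiv.Perm (Fin (m + 1)) := Equiv.ofBijective f (Finite.injective_iff_bijective.1 hinj)
  have hw : ∀ p, 1 ≤ p ∧ p ≤ m + 1 → (p, word σ p) ∈ S := by
    rintro p ⟨h1, h2⟩
    obtain ⟨j, rfl⟩ : ∃ j, p = j + 1 := ⟨p - 1, by omega⟩
    rw [word_succ σ h2]
    exact hf ⟨j, h2⟩
  have hw' : ∀ p, 1 ≤ p ∧ p ≤ m → (p, word σ p) ∈ R := by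
    intro p hp
    rcases mem_insert.1 (hw p (by omega)) with e | e
    · have := (Prod.mk.inj e).1; omega
    · exact e
  refine ⟨σ, ?_, ?_⟩
  · rw [scda_eq_zero_iff]
    intro i hi hlt
    have hi := mem_Icc.1 hi
    have hi' : i + 1 ∈ Icc 1 (m + 1) := mem_Icc.2 (by omega)
    -- Otherwise column `i + 1` has its rook in a row at most `i`, and `shift` forces `σ(i) ≤ i`.
    by_contra hc
    have hj := mem_Icc.1 (word_mem σ⁻¹ hi')
    have hmem := hw' _ ⟨hj.1, by omega⟩
    rw [word_word_inv σ hi'] at hmem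
    obtain ⟨y, hy, e1, e2⟩ := h.shift _ hmem (by simp only; omega)
    have e3 : y.1 = i := by simpa using e1
    have := h.inj_row _ (hw' i (by omega)) y hy e3.symm
    subst this
    simp only at e2
    omega
  · refine eq_of_subset_of_card_le (fun x hx => ?_) (by rw [card_graphOn, hR])
    obtain ⟨h1, h2⟩ := mem_graphOn.1 hx
    have := hw' _ h1
    rwa [← h2] at this

end Full

theorem sum_SDE_eq_rookSum (m k : ℕ) :
    ∑ σ ∈ SDE (m + 1) k, (X : ℤ[X]) ^ (inv σ - exc σ) = rookSum m (pointMass 0 (k + 1)) := by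
  -- Level 0 means that all `m` rows are occupied; the second index is then the number of excedances
  -- plus one.
  have e : rookSum m (pointMass 0 (k + 1)) =
      ∑ R ∈ partialRooks m with #R = m ∧ rookExc R = k, X ^ (rookWeight R).toNat := by
    rw [rookSum, sum_filter]
    refine sum_congr rfl fun R hR => ?_
    have := (mem_partialRooks.1 hR).card_le
    have : (m - #R = 0 ∧ m - #R + rookExc R + 1 = k + 1) ↔ #R = m ∧ rookExc R = k := by omega
    simp only [pointMass, this, mul_ite, mul_one, mul_zero]
  rw [e]
  refine sum_nbij (graphOn m) (fun σ hσ => ?_) (graphOn_injective.injOn) (fun R hR => ?_)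
    fun σ hσ => ?_
  · obtain ⟨-, h1, h2⟩ := mem_filter.1 hσ
    refine mem_filter.2 ⟨mem_partialRooks.2 (isPartial_graphOn σ h2), card_graphOn m σ, ?_⟩
    rw [rookExc_graphOn_pred, h1]
  · obtain ⟨h1, h2, h3⟩ := mem_filter.1 (mem_coe.1 hR)
    obtain ⟨σ, h4, rfl⟩ := exists_graphOn_eq (mem_partialRooks.1 h1) h2
    refine ⟨σ, ?_, rfl⟩
    simp only [SDE, coe_filter, mem_univ, true_and, Set.mem_ofPred_eq]
    exact ⟨by rw [← rookExc_graphOn_pred, h3], h4⟩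
  · obtain ⟨-, h1, h2⟩ := mem_filter.1 hσ
    have := exc_le_inv σ
    rw [rookWeight_graphOn_pred σ h2]
    congr 1
    omega

/-! ### Statistics on lists -/

/-- The number of pairs of consecutive entries related by `f`. -/
def pairCount (f : ℕ → ℕ → Prop) [DecidableRel f] : List ℕ → ℕ
  | x :: y :: t => (if f x y then 1 else 0) + pairCount f (y :: t)
  | _ => 0

/-- The number of occurrences of `2-13`, the letters playing `1` and `3` being consecutive. -/
def count2_13 : List ℕ → ℕ
  | x :: t => pairCount (fun y z => y < x ∧ x < z) t + count2_13 t
  | [] => 0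

/-- The number of double descents of a list. -/
def countDD : List ℕ → ℕ
  | p :: x :: q :: t => (if x < p ∧ q < x then 1 else 0) + countDD (x :: q :: t)
  | _ => 0

/-- The number of descents of a list. -/
abbrev countDes (M : List ℕ) : ℕ := pairCount (fun x y => y < x) M

/-- Twice the number of `31-2` plus the number of `2-13`. -/
def wordWeight (M : List ℕ) : ℕ := 2 * count2_13 M.reverse + count2_13 M

theorem pairCount_append (f : ℕ → ℕ → Prop) [DecidableRel f] (A : List ℕ) (x : ℕ) (B : List ℕ) :
    pairCount f (A ++ x :: B) = pairCount f (A ++ [x]) + pairCount f (x :: B) := by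
  induction A with
  | nil => simp [pairCount]
  | cons y A ih =>
    rcases A with _ | ⟨z, A⟩
    · simp [pairCount]
    · simp only [List.cons_append, pairCount] at ih ⊢
      rw [ih, add_assoc]

theorem pairCount_mid (f : ℕ → ℕ → Prop) [DecidableRel f] (U T V : List ℕ) (a b : ℕ) :
    pairCount f (U ++ a :: (T ++ b :: V)) =
      pairCount f (U ++ [a]) + pairCount f (a :: (T ++ [b])) + pairCount f (b :: V) := by
  rw [pairCount_append f U a, ← List.cons_append, pairCount_append f (a :: T) b, List.cons_append,
    add_assoc]

theorem countDD_append (A : List ℕ) (x y : ℕ) (B : List ℕ) :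
    countDD (A ++ x :: y :: B) = countDD (A ++ [x, y]) + countDD (x :: y :: B) := by
  induction A with
  | nil => simp [countDD]
  | cons z A ih =>
    rcases A with _ | ⟨w, _ | ⟨w', A⟩⟩
    · simp [countDD]
    · simp only [List.cons_append, countDD, List.nil_append] at ih ⊢
      omega
    · simp only [List.cons_append, countDD] at ih ⊢
      rw [ih, add_assoc]

/-- Only the direction of the step leaving `a` matters, so a hole may be exchanged for any letter
larger than `a`. -/
theorem countDD_append_ascent (U : List ℕ) {a h h' : ℕ} (hh : a < h) (hh' : a < h') :
    countDD (U ++ [a, h]) = countDD (U ++ [a, h']) := by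
  induction U with
  | nil => simp [countDD]
  | cons z A ih =>
    rcases A with _ | ⟨w, _ | ⟨w', A⟩⟩
    · simp [countDD, hh.not_gt, hh'.not_gt]
    · simp only [List.cons_append, countDD, List.nil_append] at ih ⊢
      rw [ih]
    · simp only [List.cons_append, countDD] at ih ⊢
      rw [ih]

theorem countDD_descent_cons (V : List ℕ) {b h h' : ℕ} (hh : b < h) (hh' : b < h') :
    countDD (h :: b :: V) = countDD (h' :: b :: V) := by
  rcases V with _ | ⟨c, V⟩ <;> simp [countDD, hh, hh']

theorem pairCount_eq_zero_of_le (H : ℕ) (L : List ℕ) (hL : ∀ x ∈ L, x ≤ H) :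
    pairCount (fun y z => y < H ∧ H < z) L = 0 := by
  induction L with
  | nil => rfl
  | cons x t ih =>
    rcases t with _ | ⟨y, t⟩
    · rfl
    · rw [pairCount, ih fun x hx => hL x (List.mem_cons_of_mem _ hx), if_neg]
      have := hL y (by simp)
      omega

/-! ### Words with holes -/

/-- No two consecutive entries are equal to `H`. -/
abbrev NoAdjacent (H : ℕ) (M : List ℕ) : Prop := M.IsChain fun x y => ¬(x = H ∧ y = H)

/-- Every letter but `H` is below `u` and holes are isolated, so each hole other than a leading one
is entered by exactly one step crossing the level `u`. -/
theorem pairCount_eq_count (H u : ℕ) (hu : u < H) (L : List ℕ) (hL : ∀ x ∈ L, x < u ∨ x = H)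
    (hc : NoAdjacent H L) :
    pairCount (fun y z => y < u ∧ u < z) L = L.tail.count H := by
  induction L with
  | nil => rfl
  | cons x t ih =>
    rcases t with _ | ⟨y, t⟩
    · rfl
    · have hc' := List.isChain_cons_cons.1 hc
      have hx := hL x (by simp)
      have hy := hL y (by simp)
      rw [pairCount, ih (fun x hx => hL x (List.mem_cons_of_mem _ hx)) hc'.2, List.tail_cons,
        List.tail_cons, List.count_cons, add_comm]
      congr 1
      by_cases hyH : y = H
      · rw [if_pos ⟨by omega, by omega⟩, if_pos (by simpa using hyH)]
      · rw [if_neg (by omega), if_neg (by simpa using hyH)]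

/-- The four ways of inserting the letter `u` into a hole `H`. -/
def fillers (H u : ℕ) : List (List ℕ) := [[u], [u, H], [H, u], [H, u, H]]

/-- As the letter 2, `u` sees one crossing for each hole of `V`, and `H` never has a larger letter
after it. A letter before the filler sees the same crossings as before, since all of the filler lies
above it, or it is itself `H`. -/
theorem count2_13_fill (H u : ℕ) (hu : u < H) {a b : ℕ} (ha : a < u) (hb : b < u)
    (U V T : List ℕ) (hT : T ∈ fillers H u) (hU : ∀ x ∈ U, x < u ∨ x = H)
    (hV : ∀ x ∈ V, x < u ∨ x = H) (hc : NoAdjacent H (b :: V)) :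
    count2_13 (U ++ a :: (T ++ b :: V)) = count2_13 (U ++ a :: H :: b :: V) + V.count H := by
  have hbV : ∀ x ∈ b :: V, x < u ∨ x = H := by
    simp only [List.mem_cons, forall_eq_or_imp]; exact ⟨Or.inl hb, hV⟩
  induction U with
  | nil =>
    have k1 := pairCount_eq_count H u hu (b :: V) hbV hc
    have k2 := pairCount_eq_zero_of_le H (b :: V) fun x hx => by have := hbV x hx; omega
    have k3 : ∀ L x, a ≤ x → pairCount (fun y z => y < a ∧ a < z) (x :: L) =
        pairCount (fun y z => y < a ∧ a < z) L := by
      intro L x hx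
      rcases L with _ | ⟨y, L⟩
      · rfl
      · rw [pairCount, if_neg (by omega), zero_add]
    have k4 : ∀ L x, u ≤ x → pairCount (fun y z => y < u ∧ u < z) (x :: L) =
        pairCount (fun y z => y < u ∧ u < z) L := by
      intro L x hx
      rcases L with _ | ⟨y, L⟩
      · rfl
      · rw [pairCount, if_neg (by omega), zero_add]
    have k5 : pairCount (fun y z => y < H ∧ H < z) (H :: b :: V) = 0 :=
      pairCount_eq_zero_of_le H _ fun x hx => by
        rcases List.mem_cons.1 hx with rfl | hx
        · exact le_rfl
        · have := hbV x hx; omega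
    have k6 : pairCount (fun y z => y < H ∧ H < z) (u :: b :: V) = 0 :=
      pairCount_eq_zero_of_le H _ fun x hx => by
        rcases List.mem_cons.1 hx with rfl | hx
        · exact hu.le
        · have := hbV x hx; omega
    have k7 : pairCount (fun y z => y < H ∧ H < z) (u :: H :: b :: V) = 0 := by
      rw [pairCount, k5, if_neg (by omega)]
    simp only [fillers, List.mem_cons, List.not_mem_nil, or_false] at hT
    rcases hT with rfl | rfl | rfl | rfl <;>
    · simp only [List.nil_append, List.cons_append, count2_13, k3 _ u ha.le,
        k3 _ H (ha.le.trans hu.le), k4 _ H hu.le, k1, k2, k6, k7, List.tail_cons]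
      ring
  | cons x U ih =>
    have hx := hU x (by simp)
    rw [List.cons_append, List.cons_append, count2_13, count2_13,
      ih fun x hx => hU x (List.mem_cons_of_mem _ hx), ← add_assoc]
    congr 2
    rw [pairCount_mid, show H :: b :: V = [H] ++ b :: V from rfl, pairCount_mid]
    congr 2
    simp only [fillers, List.mem_cons, List.not_mem_nil, or_false] at hT
    rcases hT with rfl | rfl | rfl | rfl <;>
    · simp only [List.nil_append, List.cons_append, pairCount]
      split_ifs <;> omega

/-- Apply `count2_13_fill` to the word and to its reversal. The fourth filler is kept in `fillers`
because reversal exchanges `[u, H]` and `[H, u]`. -/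
theorem wordWeight_fill (H u : ℕ) (hu : u < H) {a b : ℕ} (ha : a < u) (hb : b < u)
    (U V T : List ℕ) (hT : T ∈ fillers H u) (hU : ∀ x ∈ U, x < u ∨ x = H)
    (hV : ∀ x ∈ V, x < u ∨ x = H) (hc : NoAdjacent H (U ++ a :: H :: b :: V)) :
    wordWeight (U ++ a :: (T ++ b :: V)) =
      wordWeight (U ++ a :: H :: b :: V) + (2 * U.count H + V.count H) := by
  have h1 : NoAdjacent H (b :: V) := by
    have := (List.isChain_append.1 hc).2.1
    exact (this.tail).tail
  have h2 : NoAdjacent H (a :: U.reverse) := by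
    have := List.isChain_reverse.2 ((List.isChain_split.1 hc).1)
    rw [List.reverse_append] at this
    exact this.imp fun x y hxy h => hxy ⟨h.2, h.1⟩
  have hT' : T.reverse ∈ fillers H u := by
    simp only [fillers, List.mem_cons, List.not_mem_nil, or_false] at hT ⊢
    rcases hT with rfl | rfl | rfl | rfl <;> simp
  have e1 := count2_13_fill H u hu ha hb U V T hT hU hV h1
  have e2 := count2_13_fill H u hu hb ha V.reverse U.reverse T.reverse hT' (by simpa using hV)
    (by simpa using hU) h2
  have r1 : (U ++ a :: (T ++ b :: V)).reverse =
      V.reverse ++ b :: (T.reverse ++ a :: U.reverse) := by simp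
  have r2 : (U ++ a :: H :: b :: V).reverse = V.reverse ++ b :: H :: a :: U.reverse := by simp
  rw [wordWeight, wordWeight, r1, r2, e1, e2, List.count_reverse]
  ring

/-- `M` starts and ends with `0`, has each letter of `{1, …, v}` exactly once, its other
letters are holes `H`, no two of which are adjacent, and it has no double descent. -/
def IsHoled (H v : ℕ) (M : List ℕ) : Prop :=
  (∀ x, x ≠ H → M.count x = if x = 0 then 2 else if x ≤ v then 1 else 0) ∧
    M.head? = some 0 ∧ M.getLast? = some 0 ∧ NoAdjacent H M ∧ countDD M = 0

theorem IsHoled.mem_le {H v : ℕ} {M : List ℕ} (h : IsHoled H v M) {x : ℕ} (hx : x ∈ M)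
    (hH : x ≠ H) : x ≤ v := by
  have h1 := h.1 x hH
  have h2 := List.count_pos_iff.2 hx
  split_ifs at h1 <;> omega

theorem IsHoled.mem_lt_or {H v : ℕ} {M : List ℕ} (h : IsHoled H v M) {x : ℕ} (hx : x ∈ M) :
    x < v + 1 ∨ x = H := by
  by_cases hH : x = H
  · exact Or.inr hH
  · exact Or.inl (Nat.lt_succ_of_le (h.mem_le hx hH))

/-- The three ways of inserting `u` into a hole `H` without creating a double descent. -/
def ddFreeFillers (H u : ℕ) : List (List ℕ) := [[u], [u, H], [H, u, H]]

theorem ddFreeFillers_subset (H u : ℕ) : ∀ T ∈ ddFreeFillers H u, T ∈ fillers H u := by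
  simp [ddFreeFillers, fillers]

/-- The filler still rises from `a` and falls to `b`, so double descents outside it are unaffected,
and none of these three fillers creates one. -/
theorem isHoled_fill_iff {H v : ℕ} (hv : v + 1 < H) {a b : ℕ} (ha : a ≠ H) (hb : b ≠ H)
    (U V T : List ℕ) (hT : T ∈ ddFreeFillers H (v + 1)) :
    IsHoled H (v + 1) (U ++ a :: (T ++ b :: V)) ↔ IsHoled H v (U ++ a :: H :: b :: V) := by
  have hcount : ∀ x, x ≠ H → (U ++ a :: (T ++ b :: V)).count x =
      (U ++ a :: H :: b :: V).count x + if x = v + 1 then 1 else 0 := by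
    intro x hx
    simp only [ddFreeFillers, List.mem_cons, List.not_mem_nil, or_false] at hT
    rcases hT with rfl | rfl | rfl <;>
    · simp only [List.count_append, List.count_cons, List.cons_append, List.nil_append,
        beq_iff_eq, hx.symm, if_false, eq_comm (a := v + 1)]
      ring
  have h1 : (∀ x, x ≠ H → (U ++ a :: (T ++ b :: V)).count x =
        if x = 0 then 2 else if x ≤ v + 1 then 1 else 0) ↔
      ∀ x, x ≠ H → (U ++ a :: H :: b :: V).count x =
        if x = 0 then 2 else if x ≤ v then 1 else 0 := by
    refine forall₂_congr fun x hx => ?_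
    rw [hcount x hx]
    split_ifs <;> omega
  have h2 : (U ++ a :: (T ++ b :: V)).head? = (U ++ a :: H :: b :: V).head? := by
    rcases U with _ | ⟨c, U⟩ <;> simp
  have h3 : (U ++ a :: (T ++ b :: V)).getLast? = (U ++ a :: H :: b :: V).getLast? := by
    rw [show U ++ a :: (T ++ b :: V) = (U ++ a :: T) ++ b :: V by simp,
      show U ++ a :: H :: b :: V = (U ++ [a, H]) ++ b :: V by simp,
      List.getLast?_append_cons, List.getLast?_append_cons]
  have h4 : NoAdjacent H (U ++ a :: (T ++ b :: V)) ↔ NoAdjacent H (U ++ a :: H :: b :: V) := by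
    unfold NoAdjacent
    rw [List.isChain_split, List.isChain_split (l₂ := H :: b :: V)]
    refine and_congr_right fun _ => ?_
    simp only [ddFreeFillers, List.mem_cons, List.not_mem_nil, or_false] at hT
    rcases hT with rfl | rfl | rfl <;>
      simp [List.isChain_cons_cons, ha, hb, hv.ne]
  unfold IsHoled
  rw [h1, h2, h3, h4]
  refine and_congr_right fun hc => and_congr_right fun _ => and_congr_right fun _ =>
    and_congr_right fun _ => ?_
  have hlt : ∀ x ∈ U ++ a :: H :: b :: V, x ≠ H → x < v + 1 := by
    intro x hx hxH
    have h1 := hc x hxH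
    have h2 := List.count_pos_iff.2 hx
    split_ifs at h1 <;> omega
  have ha' : a < v + 1 := hlt a (by simp) ha
  have hb' : b < v + 1 := hlt b (by simp) hb
  suffices e : countDD (U ++ a :: (T ++ b :: V)) = countDD (U ++ a :: H :: b :: V) by rw [e]
  simp only [ddFreeFillers, List.mem_cons, List.not_mem_nil, or_false] at hT
  rw [countDD_append U a H]
  rcases hT with rfl | rfl | rfl
  · rw [List.cons_append, countDD_append, countDD_append_ascent U ha' (ha'.trans hv)]
    simp only [List.nil_append, countDD]
    rw [countDD_descent_cons V hb' (hb'.trans hv), if_neg (by omega), if_neg (by omega)]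
  · rw [List.cons_append, countDD_append, countDD_append_ascent U ha' (ha'.trans hv)]
    simp only [List.nil_append, List.cons_append, countDD]
    rw [if_neg (by omega), if_neg (by omega), if_neg (by omega), zero_add]
  · rw [List.cons_append, countDD_append]
    simp only [List.nil_append, List.cons_append, countDD]
    rw [if_neg (by omega), if_neg (by omega), if_neg (by omega), if_neg (by omega)]
    simp only [zero_add]

theorem IsHoled.exists_split {H v : ℕ} {M A B : List ℕ} (hH : 0 < H) (h : IsHoled H v M)
    (e : A ++ H :: B = M) :
    ∃ U a b V, A = U ++ [a] ∧ B = b :: V ∧ a ≠ H ∧ b ≠ H := by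
  subst e
  obtain ⟨-, h2, h3, h4, -⟩ := h
  rcases List.eq_nil_or_concat A with rfl | ⟨U, a, rfl⟩
  · simp at h2; omega
  rcases B with _ | ⟨b, V⟩
  · simp at h3; omega
  refine ⟨U, a, b, V, by simp, rfl, ?_, ?_⟩
  · have h5 : NoAdjacent H (U ++ a :: H :: b :: V) := by simpa using h4
    have := (List.isChain_append.1 h5).2.1
    have := (List.isChain_cons_cons.1 this).1
    tauto
  · have := (List.isChain_append.1 h4).2.1
    have := (List.isChain_cons_cons.1 this).1
    tauto

/-- The neighbours of the largest letter `v + 1` reveal the filler: it consists of that letter and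
the holes adjacent to it. -/
theorem IsHoled.exists_fill {H v : ℕ} (hv : v + 1 < H) {M : List ℕ} (h : IsHoled H (v + 1) M) :
    ∃ U a b V, ∃ T ∈ ddFreeFillers H (v + 1), a ≠ H ∧ b ≠ H ∧ M = U ++ a :: (T ++ b :: V) := by
  have hmem : v + 1 ∈ M := by
    rw [← List.count_pos_iff, h.1 _ hv.ne]; simp
  obtain ⟨P, Q, rfl⟩ := List.append_of_mem hmem
  have hle := fun x hx => h.mem_le (x := x) hx
  obtain ⟨h1, h2, h3, h4, h5⟩ := h
  have hcu := h1 (v + 1) hv.ne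
  rcases List.eq_nil_or_concat' P with rfl | ⟨U, p, rfl⟩
  · simp at h2
  rcases Q with _ | ⟨q, V⟩
  · simp at h3
  have e : U ++ [p] ++ (v + 1) :: q :: V = U ++ p :: (v + 1) :: q :: V := by simp
  rw [e] at hle h1 h2 h3 h4 h5 hcu
  have hchain := (List.isChain_append.1 h4).2.1
  have hq : ∀ c W, q = H → V = c :: W → c ≠ H := by
    rintro c W rfl rfl
    have := (List.isChain_cons_cons.1 hchain.tail.tail).1
    tauto
  have hqV : q = H → V ≠ [] := by
    rintro rfl rfl
    simp at h3
    omega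
  by_cases hp : p = H
  · subst hp
    have hU : U ≠ [] := by
      rintro rfl
      simp at h2
      omega
    obtain ⟨U, a, rfl⟩ := (List.eq_nil_or_concat' U).resolve_left hU
    have e : U ++ [a] ++ p :: (v + 1) :: q :: V = U ++ a :: p :: (v + 1) :: q :: V := by simp
    rw [e] at hle h1 h2 h3 h4 h5 hcu
    have ha : a ≠ p := by
      have := (List.isChain_append.1 h4).2.1
      have := (List.isChain_cons_cons.1 this).1
      tauto
    by_cases hq' : q = p
    · subst hq'
      rcases V with _ | ⟨b, V⟩
      · exact absurd rfl (hqV rfl)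
      · exact ⟨U, a, b, V, [q, v + 1, q], by simp [ddFreeFillers], ha, hq b V rfl rfl,
          by simp⟩
    -- With a hole on the left only, `H > v + 1 > q` is a double descent.
    · exfalso
      have h6 := hle q (by simp) hq'
      have h7 : q ≠ v + 1 := by
        rintro rfl
        simp [List.count_append, List.count_cons] at hcu
        omega
      rw [show U ++ a :: p :: (v + 1) :: q :: V = (U ++ [a]) ++ p :: (v + 1) :: q :: V by simp,
        countDD_append, countDD, if_pos (by omega)] at h5
      omega
  · by_cases hq' : q = H
    · subst hq'
      rcases V with _ | ⟨b, V⟩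
      · exact absurd rfl (hqV rfl)
      · exact ⟨U, p, b, V, [v + 1, q], by simp [ddFreeFillers], hp, hq b V rfl rfl, by simp⟩
    · exact ⟨U, p, q, V, [v + 1], by simp [ddFreeFillers], hp, hq', by simp⟩

/-! ### Choosing a hole; the generating function of words with holes -/

/-- The ways of writing `M` as `A ++ H :: B`. -/
def splits (H : ℕ) (M : List ℕ) : Finset (List ℕ × List ℕ) :=
  {p ∈ (range M.length).image fun i => (M.take i, M.drop (i + 1)) | p.1 ++ H :: p.2 = M}

theorem mem_splits {H : ℕ} {M : List ℕ} {p : List ℕ × List ℕ} :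
    p ∈ splits H M ↔ p.1 ++ H :: p.2 = M := by
  rw [splits, mem_filter, and_iff_right_iff_imp]
  rintro rfl
  refine mem_image.2 ⟨p.1.length, by simp, ?_⟩
  ext1 <;> simp [List.drop_append]

theorem splits_cons (H x : ℕ) (t : List ℕ) :
    splits H (x :: t) = (splits H t).image (fun p => (x :: p.1, p.2)) ∪
      if x = H then {([], t)} else ∅ := by
  ext ⟨A, B⟩
  simp only [mem_splits, mem_union, mem_image, Prod.exists, Prod.mk.injEq]
  rcases A with _ | ⟨y, A⟩
  · by_cases hx : x = H
    · simp [hx, eq_comm]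
    · simp [hx, eq_comm (a := H)]
  · by_cases hx : x = H
    · simp [hx, eq_comm, and_comm]
    · simp [hx, eq_comm, and_comm]

/-- As the chosen hole moves through `M`, the number of holes to its left takes each value below
`M.count H` once. -/
theorem sum_splits (H : ℕ) (M : List ℕ) :
    ∑ p ∈ splits H M, (X : ℤ[X]) ^ p.1.count H = qNum (M.count H) := by
  induction M with
  | nil => simp [splits]
  | cons x t ih =>
    have hinj : Set.InjOn (fun p : List ℕ × List ℕ => (x :: p.1, p.2)) (splits H t) := by
      rintro ⟨A, B⟩ - ⟨A', B'⟩ - e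
      simpa using e
    rw [splits_cons]
    by_cases hx : x = H
    · subst hx
      rw [if_pos rfl, sum_union, sum_image hinj, sum_singleton]
      · simp only [List.count_cons_self, List.count_nil, pow_zero, pow_succ]
        rw [← sum_mul, ih, qNum, qNum, sum_range_succ', sum_mul]
        simp only [pow_succ, pow_zero]
      · rw [disjoint_singleton_right, mem_image]
        rintro ⟨p, -, hp⟩
        simp at hp
    · rw [if_neg hx, union_empty, sum_image hinj]
      simp only [List.count_cons_of_ne hx]
      exact ih

/-- The words with holes reached after the insertion of the letters `1, …, v`. -/
def holedWords (H : ℕ) : ℕ → Finset (List ℕ)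
  | 0 => {[0, H, 0]}
  | v + 1 => (ddFreeFillers H (v + 1)).toFinset.biUnion fun T =>
      ((holedWords H v).biUnion (splits H)).image fun p => p.1 ++ (T ++ p.2)

/-- Demanding a hole excludes `[0, 0]`, the only other holed word without positive letters. -/
theorem isHoled_zero_iff {H : ℕ} (hH : 0 < H) {M : List ℕ} :
    IsHoled H 0 M ∧ H ∈ M ↔ M = [0, H, 0] := by
  constructor
  · rintro ⟨h, hm⟩
    have hle := fun x hx => h.mem_le (x := x) hx
    obtain ⟨h1, h2, h3, h4, -⟩ := h
    have hc := h1 0 hH.ne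
    rcases M with _ | ⟨c, N⟩
    · simp at h2
    obtain rfl : c = 0 := by simpa using h2
    rcases List.eq_nil_or_concat' N with rfl | ⟨N, d, rfl⟩
    · simp at hm
      omega
    obtain rfl : d = 0 := by simpa [List.getLast?_cons] using h3
    have hN0 : 0 ∉ N := by
      rw [← List.count_eq_zero]
      simp at hc
      simpa using hc
    have hN : ∀ x ∈ N, x = H := by
      intro x hx
      by_contra hxH
      have := hle x (by simp [hx]) hxH
      obtain rfl : x = 0 := by omega
      exact hN0 hx
    rcases N with _ | ⟨x, _ | ⟨y, N⟩⟩
    · simp at hm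
      omega
    · rw [hN x (by simp)]
      rfl
    · exfalso
      exact (List.isChain_cons_cons.1 h4.tail).1 ⟨hN x (by simp), hN y (by simp)⟩
  · rintro rfl
    refine ⟨⟨fun x hx => ?_, rfl, rfl, ?_, ?_⟩, by simp⟩
    · rcases eq_or_ne x 0 with rfl | h0
      · simp [hH.ne']
      · simp [h0, h0.symm, hx.symm]
    · simp [NoAdjacent, List.isChain_cons_cons, hH.ne]
    · simp [countDD]

theorem mem_holedWords {H v : ℕ} (hv : v < H) {M : List ℕ} :
    M ∈ holedWords H v ↔ IsHoled H v M ∧ (v = 0 → H ∈ M) := by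
  induction v generalizing M with
  | zero => rw [holedWords, mem_singleton, ← isHoled_zero_iff hv]; simp
  | succ v ih =>
    simp only [holedWords, mem_biUnion, List.mem_toFinset, mem_image, mem_splits,
      ih (Nat.lt_of_succ_lt hv), Nat.add_eq_zero_iff, one_ne_zero, and_false, false_imp_iff,
      and_true]
    constructor
    · rintro ⟨T, hT, ⟨A, B⟩, ⟨M, ⟨hM, -⟩, e⟩, rfl⟩
      obtain ⟨U, a, b, V, rfl, rfl, ha, hb⟩ := hM.exists_split (by omega) e
      subst e
      have := (isHoled_fill_iff hv ha hb U V T hT).2 (by simpa using hM)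
      simpa using this
    · intro h
      obtain ⟨U, a, b, V, T, hT, ha, hb, rfl⟩ := h.exists_fill hv
      exact ⟨T, hT, (U ++ [a], b :: V), ⟨_, ⟨(isHoled_fill_iff hv ha hb U V T hT).1 h, by simp⟩,
        by simp⟩, by simp⟩

/-- The letter `v + 1` occurs once, which locates the cut. The pieces around the filler do not
border it with holes, so the holes next to `v + 1` determine the filler. -/
theorem fill_injective {H v : ℕ} (hv : v + 1 < H) {T T' : List ℕ}
    (hT : T ∈ ddFreeFillers H (v + 1)) (hT' : T' ∈ ddFreeFillers H (v + 1))
    {p p' : List ℕ × List ℕ} (hp : p ∈ (holedWords H v).biUnion (splits H))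
    (hp' : p' ∈ (holedWords H v).biUnion (splits H))
    (e : p.1 ++ (T ++ p.2) = p'.1 ++ (T' ++ p'.2)) : T = T' ∧ p = p' := by
  obtain ⟨A, B⟩ := p
  obtain ⟨A', B'⟩ := p'
  simp only [mem_biUnion, mem_splits, mem_holedWords (Nat.lt_of_succ_lt hv)] at hp hp'
  obtain ⟨M, ⟨hM, -⟩, eM⟩ := hp
  obtain ⟨M', ⟨hM', -⟩, eM'⟩ := hp'
  have hnot : ∀ {M A B : List ℕ}, IsHoled H v M → A ++ H :: B = M →
      v + 1 ∉ A ∧ v + 1 ∉ B ∧ A.getLast? ≠ some H ∧ B.head? ≠ some H := by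
    intro M A B hM eM
    obtain ⟨U, a, b, V, rfl, rfl, ha, hb⟩ := hM.exists_split (by omega) eM
    have hu : v + 1 ∉ M := fun hm => by
      have := hM.mem_le hm hv.ne
      omega
    subst eM
    refine ⟨fun hm => hu ?_, fun hm => hu ?_, by simpa using ha, by simpa using hb⟩
    · exact List.mem_append_left _ hm
    · exact List.mem_append_right _ (List.mem_cons_of_mem _ hm)
  obtain ⟨n1, n2, n3, n4⟩ := hnot hM eM
  obtain ⟨n1', n2', n3', n4'⟩ := hnot hM' eM'
  have hshape : ∀ T ∈ ddFreeFillers H (v + 1), ∃ L R, T = L ++ (v + 1) :: R ∧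
      (L = [] ∨ L = [H]) ∧ (R = [] ∨ R = [H]) := by
    intro T hT
    simp only [ddFreeFillers, List.mem_cons, List.not_mem_nil, or_false] at hT
    rcases hT with rfl | rfl | rfl
    · exact ⟨[], [], by simp⟩
    · exact ⟨[], [H], by simp⟩
    · exact ⟨[H], [H], by simp⟩
  obtain ⟨L, R, rfl, hL, hR⟩ := hshape T hT
  obtain ⟨L', R', rfl, hL', hR'⟩ := hshape T' hT'
  have e' : (A ++ L) ++ (v + 1) :: (R ++ B) = (A' ++ L') ++ (v + 1) :: (R' ++ B') := by
    simpa using e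
  have hne : v + 1 ≠ H := hv.ne
  rw [List.append_cons_inj_of_notMem (by rcases hL with rfl | rfl <;> simp [n1, hne])
    (by rcases hR with rfl | rfl <;> simp [n2, hne])] at e'
  obtain ⟨e1, -, e2⟩ := e'
  have h1 : A = A' ∧ L = L' := by
    rcases hL with rfl | rfl <;> rcases hL' with rfl | rfl
    · simpa using e1
    · rw [List.append_nil] at e1
      simp [e1] at n3
    · rw [List.append_nil] at e1
      simp [← e1] at n3'
    · simpa using e1
  have h2 : B = B' ∧ R = R' := by
    rcases hR with rfl | rfl <;> rcases hR' with rfl | rfl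
    · simpa using e2
    · rw [List.nil_append] at e2
      simp [e2] at n4
    · rw [List.nil_append] at e2
      simp [← e2] at n4'
    · simpa using e2
  rw [h1.1, h1.2, h2.1, h2.2]
  exact ⟨rfl, rfl⟩

/-- The generating function of words with holes tested against a function `ψ` of the number of
holes and of the number of descents. -/
noncomputable def wordSum (H v : ℕ) (ψ : ℕ → ℕ → ℤ[X]) : ℤ[X] :=
  ∑ M ∈ holedWords H v, X ^ wordWeight M * ψ (M.count H) (countDes M)

theorem wordSum_zero {H : ℕ} (hH : 0 < H) (ψ : ℕ → ℕ → ℤ[X]) : wordSum H 0 ψ = ψ 1 1 := by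
  simp [wordSum, holedWords, wordWeight, count2_13, pairCount, hH, hH.ne]

theorem sum_holedWords_succ {M : Type*} [AddCommMonoid M] {H v : ℕ} (hv : v + 1 < H)
    (g : List ℕ → M) :
    ∑ N ∈ holedWords H (v + 1), g N = ∑ N ∈ holedWords H v, ∑ p ∈ splits H N,
      (g (p.1 ++ ([v + 1] ++ p.2)) + g (p.1 ++ ([v + 1, H] ++ p.2)) +
        g (p.1 ++ ([H, v + 1, H] ++ p.2))) := by
  have hnd : (ddFreeFillers H (v + 1)).Nodup := by simp [ddFreeFillers, hv.ne]
  rw [holedWords, sum_biUnion, List.sum_toFinset _ hnd]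
  · rw [← sum_biUnion (f := fun p : List ℕ × List ℕ => g (p.1 ++ ([v + 1] ++ p.2)) +
      g (p.1 ++ ([v + 1, H] ++ p.2)) + g (p.1 ++ ([H, v + 1, H] ++ p.2)))]
    · simp only [ddFreeFillers, List.map_cons, List.map_nil, List.sum_cons, List.sum_nil, add_zero,
        sum_add_distrib]
      rw [add_assoc]
      refine congr_arg₂ _ (sum_image ?_) (congr_arg₂ _ (sum_image ?_) (sum_image ?_)) <;>
      · intro p hp p' hp' e
        exact (fill_injective hv (by simp [ddFreeFillers]) (by simp [ddFreeFillers]) hp hp' e).2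
    · intro N _ N' _ hne
      refine disjoint_left.2 fun p hp hp' => hne ?_
      rw [← mem_splits.1 hp, ← mem_splits.1 hp']
  · intro T hT T' hT' hne
    refine disjoint_left.2 fun N hN hN' => hne ?_
    obtain ⟨p, hp, rfl⟩ := mem_image.1 hN
    obtain ⟨p', hp', e⟩ := mem_image.1 hN'
    exact (fill_injective hv (by simpa using hT') (by simpa using hT) hp' hp e).1.symm

/-- With `l` holes to the left of the chosen one and `r` to its right, the exponent `2l + r` is `l`
plus the constant `M.count H - 1`; `sum_splits` then sums over `l`. -/
theorem wordSum_succ {H v : ℕ} (hv : v + 1 < H) (ψ : ℕ → ℕ → ℤ[X]) :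
    wordSum H (v + 1) ψ = wordSum H v (wordStep ψ) := by
  rw [wordSum, sum_holedWords_succ hv]
  refine sum_congr rfl fun M hM => ?_
  have hM := ((mem_holedWords (Nat.lt_of_succ_lt hv)).1 hM).1
  have key : ∀ p ∈ splits H M, ∀ T ∈ ddFreeFillers H (v + 1),
      X ^ wordWeight (p.1 ++ (T ++ p.2)) *
        ψ ((p.1 ++ (T ++ p.2)).count H) (countDes (p.1 ++ (T ++ p.2))) =
      X ^ p.1.count H * (X ^ wordWeight M * X ^ (M.count H - 1) *
        ψ (M.count H - 1 + T.count H) (countDes M + (T.count H - 1))) := by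
    rintro ⟨A, B⟩ hp T hT
    rw [mem_splits] at hp
    obtain ⟨U, a, b, V, rfl, rfl, ha, hb⟩ := hM.exists_split (by omega) hp
    simp only at hp
    have hM' : M = U ++ a :: H :: b :: V := by rw [← hp]; simp
    subst hM'
    have hlt := fun x hx => hM.mem_lt_or (x := x) hx
    have ha' : a < v + 1 := (hlt a (by simp)).resolve_right ha
    have hb' : b < v + 1 := (hlt b (by simp)).resolve_right hb
    have ew := wordWeight_fill H (v + 1) hv ha' hb' U V T (ddFreeFillers_subset _ _ T hT)
      (fun x hx => hlt x (by simp [hx])) (fun x hx => hlt x (by simp [hx])) hM.2.2.2.1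
    have ec : (U ++ a :: H :: b :: V).count H = U.count H + V.count H + 1 := by
      simp [List.count_append, ha, hb, ← add_assoc]
    have ec' : (U ++ a :: (T ++ b :: V)).count H = U.count H + V.count H + T.count H := by
      simp [List.count_append, ha, hb]; ring
    -- Between `a` and `b` there is one descent for `[u]` and `[u, H]`, two for `[H, u, H]`. The
    -- truncated subtraction gives the increments 0, 0, 1.
    have ed : countDes (U ++ a :: (T ++ b :: V)) =
        countDes (U ++ a :: H :: b :: V) + (T.count H - 1) := by
      have e3 := pairCount_mid (fun x y => y < x) U [H] V a b
      rw [List.singleton_append] at e3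
      rw [countDes, countDes, pairCount_mid, e3]
      simp only [ddFreeFillers, List.mem_cons, List.not_mem_nil, or_false] at hT
      have d1 := ha'.trans hv
      have d2 := hb'.trans hv
      rcases hT with rfl | rfl | rfl <;>
      · simp [pairCount, hv.ne, hv, hv.not_gt, d1.not_gt, d2, ha'.not_gt, hb']
        try omega
    have e4 : (U ++ [a]) ++ (T ++ b :: V) = U ++ a :: (T ++ b :: V) := by simp
    have e5 : (U ++ [a]).count H = U.count H := by simp [ha]
    simp only
    rw [e4, e5, ew, ec', ed, ec, Nat.add_sub_cancel,
      show 2 * U.count H + V.count H = U.count H + (U.count H + V.count H) by ring, pow_add,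
      pow_add]
    ring
  have c1 : ([v + 1] : List ℕ).count H = 0 := by simp [hv.ne]
  have c2 : ([v + 1, H] : List ℕ).count H = 1 := by simp [hv.ne]
  have c3 : ([H, v + 1, H] : List ℕ).count H = 2 := by simp [hv.ne]
  rw [sum_congr rfl fun p hp => by
    rw [key p hp [v + 1] (by simp [ddFreeFillers]), key p hp [v + 1, H] (by simp [ddFreeFillers]),
      key p hp [H, v + 1, H] (by simp [ddFreeFillers]), ← mul_add, ← mul_add]]
  rw [← sum_mul, sum_splits, c1, c2, c3, wordStep]
  rcases Nat.eq_zero_or_pos (M.count H) with h0 | h0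
  · simp [h0]
  · rw [Nat.sub_add_cancel h0, show M.count H - 1 + 2 = M.count H + 1 by omega]
    simp only [add_zero, Nat.sub_self, zero_tsub]
    ring

theorem wordSum_eq {H : ℕ} (v : ℕ) (hv : v < H) (ψ : ℕ → ℕ → ℤ[X]) :
    wordSum H v ψ = wordStep^[v] ψ 1 1 := by
  induction v generalizing ψ with
  | zero => exact wordSum_zero hv ψ
  | succ v ih => rw [wordSum_succ hv, ih (Nat.lt_of_succ_lt hv), Function.iterate_succ_apply]

/-! ### Permutations as words without holes -/

theorem pairCount_map_range' (P : ℕ → ℕ → Prop) [DecidableRel P] (f : ℕ → ℕ) (s m : ℕ) :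
    pairCount P ((List.range' s m).map f) =
      ∑ j ∈ Ico s (s + m - 1), if P (f j) (f (j + 1)) then 1 else 0 := by
  induction m generalizing s with
  | zero => simp [pairCount]
  | succ m ih =>
    rcases m with _ | m
    · simp [pairCount]
    · have ih := ih (s + 1)
      simp only [List.range'_succ, List.map_cons, pairCount] at ih ⊢
      rw [ih, sum_eq_sum_Ico_succ_bot (by omega : s < s + (m + 1 + 1) - 1),
        show s + 1 + (m + 1) - 1 = s + (m + 1 + 1) - 1 by omega]

theorem count2_13_map_range' (f : ℕ → ℕ) (s m : ℕ) :
    count2_13 ((List.range' s m).map f) =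
      ∑ i ∈ Ico s (s + m), ∑ j ∈ Ico (i + 1) (s + m - 1),
        if f j < f i ∧ f i < f (j + 1) then 1 else 0 := by
  induction m generalizing s with
  | zero => simp [count2_13]
  | succ m ih =>
    rw [List.range'_succ, List.map_cons, count2_13, ih, pairCount_map_range',
      sum_eq_sum_Ico_succ_bot (by omega : s < s + (m + 1)),
      show s + 1 + m = s + (m + 1) by omega]

theorem countDD_map_range' (f : ℕ → ℕ) (s m : ℕ) :
    countDD ((List.range' s m).map f) =
      ∑ i ∈ Ico (s + 1) (s + m - 1), if f i < f (i - 1) ∧ f (i + 1) < f i then 1 else 0 := by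
  induction m generalizing s with
  | zero => rw [Ico_eq_empty_of_le (by omega)]; rfl
  | succ m ih =>
    rcases m with _ | _ | m
    · simp [countDD]
    · simp [countDD, List.range'_succ]
    · have ih := ih (s + 1)
      simp only [List.range'_succ, List.map_cons, countDD] at ih ⊢
      rw [ih, sum_eq_sum_Ico_succ_bot (by omega : s + 1 < s + (m + 1 + 1 + 1) - 1),
        show s + 1 + (m + 1 + 1) - 1 = s + (m + 1 + 1 + 1) - 1 by omega, Nat.add_sub_cancel]

theorem count_map_range' (f : ℕ → ℕ) (s m x : ℕ) :
    ((List.range' s m).map f).count x = #{i ∈ Ico s (s + m) | f i = x} := by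
  rw [card_filter]
  induction m generalizing s with
  | zero => simp
  | succ m ih =>
    rw [List.range'_succ, List.map_cons, List.count_cons, ih,
      sum_eq_sum_Ico_succ_bot (by omega : s < s + (m + 1)),
      show s + 1 + m = s + (m + 1) by omega, add_comm]
    simp

theorem noAdjacent_of_notMem {H : ℕ} {M : List ℕ} (h : H ∉ M) : NoAdjacent H M := by
  induction M with
  | nil => exact List.isChain_nil
  | cons x t ih =>
    rcases t with _ | ⟨y, t⟩
    · exact List.isChain_singleton _
    · refine List.isChain_cons_cons.2 ⟨fun hxy => h ?_, ih fun hm => h ?_⟩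
      · rw [hxy.1]; exact List.mem_cons_self
      · exact List.mem_cons_of_mem _ hm

section Padded

variable {n : ℕ} (σ : Equiv.Perm (Fin n))

/-- The list `0, σ(1), …, σ(n), 0`. -/
def paddedWord : List ℕ := (List.range' 0 (n + 2)).map (word σ)

/-- The extra descent is the final drop from `σ(n)` to the padding 0. -/
theorem countDes_paddedWord (hn : 0 < n) : countDes (paddedWord σ) = des σ + 1 := by
  rw [countDes, paddedWord, pairCount_map_range', des, card_filter,
    show 0 + (n + 2) - 1 = n - 1 + 1 + 1 by omega, sum_Ico_succ_top (by omega),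
    sum_eq_sum_Ico_succ_bot (by omega), word_zero, if_neg (by omega), zero_add, zero_add,
    if_pos]
  · rfl
  · have := mem_Icc.1 (word_mem σ (mem_Icc.2 ⟨hn, le_rfl⟩))
    rw [Nat.sub_add_cancel hn, word_of_lt σ (by omega)]
    omega

theorem countDD_paddedWord : countDD (paddedWord σ) = dd σ := by
  rw [paddedWord, countDD_map_range', dd, card_filter]
  refine sum_congr ?_ fun _ _ => rfl
  ext i
  rw [mem_Ico, mem_Icc]
  omega

theorem count2_13_paddedWord : count2_13 (paddedWord σ) = v2_13 σ := by
  rw [paddedWord, count2_13_map_range', v2_13]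
  symm
  refine sum_subset_zero_on_sdiff (fun i hi => ?_) (fun i hi => ?_) fun i hi => ?_
  · rw [mem_Icc] at hi
    exact mem_Ico.2 (by omega)
  · rw [mem_sdiff, mem_Ico, mem_Icc] at hi
    refine sum_eq_zero fun j hj => if_neg ?_
    rw [mem_Ico] at hj
    obtain rfl : i = 0 := by omega
    rw [word_zero]
    omega
  · rw [v2_13At, card_filter]
    rw [mem_Icc] at hi
    refine sum_subset_zero_on_sdiff (fun j hj => ?_) (fun j hj => if_neg ?_) fun j hj => rfl
    · rw [mem_Ioo] at hj
      exact mem_Ico.2 (by omega)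
    · rw [mem_sdiff, mem_Ico, mem_Ioo] at hj
      obtain rfl : j = n := by omega
      rw [word_of_lt σ (Nat.lt_succ_self j)]
      omega

theorem word_mul_revPerm {i : ℕ} (hi : i ≤ n + 1) :
    word (σ * Fin.revPerm) i = word σ (n + 1 - i) := by
  rcases Nat.eq_zero_or_pos i with rfl | h0
  · rw [word_zero, word_of_lt σ (by omega)]
  rcases hi.eq_or_lt with rfl | hi
  · rw [word_of_lt _ (by omega), Nat.sub_self, word_zero]
  · obtain ⟨j, rfl⟩ : ∃ j, i = j + 1 := ⟨i - 1, by omega⟩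
    have hj : j < n := by omega
    rw [word_succ _ hj, show n + 1 - (j + 1) = (n - (j + 1)) + 1 by omega,
      word_succ σ (by omega : n - (j + 1) < n)]
    rfl

theorem paddedWord_reverse : (paddedWord σ).reverse = paddedWord (σ * Fin.revPerm) := by
  refine List.ext_getElem (by simp [paddedWord]) fun i h1 h2 => ?_
  have hi : i < n + 2 := by simpa [paddedWord] using h2
  simp only [paddedWord, List.getElem_reverse, List.getElem_map, List.getElem_range',
    List.length_map, List.length_range']
  rw [show 0 + 1 * i = i by ring, word_mul_revPerm σ (by omega)]
  congr 1
  omega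

theorem v2_13_mul_revPerm : v2_13 (σ * Fin.revPerm) = v31_2 σ := by
  rw [v2_13, v31_2]
  refine sum_nbij' (fun i => n + 1 - i) (fun i => n + 1 - i) (fun i hi => ?_) (fun i hi => ?_)
    (fun i hi => ?_) (fun i hi => ?_) fun i hi => ?_ <;> rw [mem_Icc] at hi
  · exact mem_Icc.2 (by omega)
  · exact mem_Icc.2 (by omega)
  · omega
  · omega
  · rw [v2_13At, v31_2At]
    refine card_nbij' (fun j => n + 1 - j) (fun j => n + 1 - j) (fun j hj => ?_) (fun j hj => ?_)
      (fun j hj => ?_) (fun j hj => ?_)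
    all_goals simp only [coe_filter, mem_Ioo, Set.mem_ofPred_eq] at hj ⊢
    · rw [word_mul_revPerm σ (by omega), word_mul_revPerm σ (by omega),
        word_mul_revPerm σ (by omega)] at hj
      exact ⟨by omega, hj.2⟩
    · rw [word_mul_revPerm σ (by omega), word_mul_revPerm σ (by omega),
        word_mul_revPerm σ (by omega), show n + 1 - (n + 1 - j) = j by omega,
        show n + 1 - (n + 1 - j + 1) = j - 1 by omega]
      exact ⟨by omega, hj.2⟩
    · omega
    · omega

theorem wordWeight_paddedWord : wordWeight (paddedWord σ) = 2 * v31_2 σ + v2_13 σ := by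
  rw [wordWeight, paddedWord_reverse, count2_13_paddedWord, count2_13_paddedWord,
    v2_13_mul_revPerm]

theorem word_le (i : ℕ) : word σ i ≤ n := by
  by_cases hi : i ∈ Icc 1 n
  · exact (mem_Icc.1 (word_mem σ hi)).2
  · rw [word, dif_neg (by simpa using hi)]
    exact Nat.zero_le n

theorem succ_notMem_paddedWord : n + 1 ∉ paddedWord σ := by
  intro h
  obtain ⟨i, -, hi⟩ := List.mem_map.1 h
  have := word_le σ i
  omega

theorem count_paddedWord (x : ℕ) :
    (paddedWord σ).count x = if x = 0 then 2 else if x ≤ n then 1 else 0 := by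
  rw [paddedWord, count_map_range']
  split_ifs with h0 hx
  · subst h0
    rw [show ({i ∈ Ico 0 (0 + (n + 2)) | word σ i = 0}) = {0, n + 1} by
      ext i
      rw [mem_filter, mem_Ico, mem_insert, mem_singleton]
      constructor
      · rintro ⟨h1, h2⟩
        by_contra h3
        have := mem_Icc.1 (word_mem σ (mem_Icc.2 (by omega : 1 ≤ i ∧ i ≤ n)))
        omega
      · rintro (rfl | rfl)
        · exact ⟨by omega, word_zero σ⟩
        · exact ⟨by omega, word_of_lt σ (by omega)⟩]
    exact card_pair (by omega)
  · have hx' : x ∈ Icc 1 n := mem_Icc.2 (by omega)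
    have h1 := mem_Icc.1 (word_mem σ⁻¹ hx')
    rw [card_eq_one]
    refine ⟨word σ⁻¹ x, ?_⟩
    ext i
    rw [mem_filter, mem_Ico, mem_singleton]
    constructor
    · rintro ⟨h2, rfl⟩
      by_cases hi : i ∈ Icc 1 n
      · rw [word_inv_word σ hi]
      · rw [word, dif_neg (by simpa using hi)] at h0
        exact absurd rfl h0
    · rintro rfl
      exact ⟨by omega, word_word_inv σ hx'⟩
  · rw [card_eq_zero]
    refine filter_false_of_mem fun i _ h => ?_
    have := word_le σ i
    omega

theorem isHoled_paddedWord (h : dd σ = 0) : IsHoled (n + 1) n (paddedWord σ) := by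
  refine ⟨fun x _ => count_paddedWord σ x, ?_, ?_, noAdjacent_of_notMem (succ_notMem_paddedWord σ),
    (countDD_paddedWord σ).trans h⟩
  · simp [paddedWord, List.range'_succ, word_zero]
  · rw [paddedWord, List.range'_concat, List.map_append]
    simp [word_of_lt]

theorem paddedWord_injective :
    Function.Injective (paddedWord : Equiv.Perm (Fin n) → List ℕ) := by
  intro σ τ e
  refine word_injective (funext fun i => ?_)
  by_cases hi : i < n + 2
  · exact List.map_inj_left.1 e i (by simp [List.mem_range'_1, hi])
  · rw [word_of_lt σ (by omega), word_of_lt τ (by omega)]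

end Padded

/-- Once the two outer zeros are stripped, the multiplicities say that each of `1, …, n` occurs
exactly once. -/
theorem exists_paddedWord_eq {n : ℕ} {M : List ℕ} (h : IsHoled (n + 1) n M)
    (h0 : M.count (n + 1) = 0) (hn : 0 < n) : ∃ σ : Equiv.Perm (Fin n), paddedWord σ = M := by
  have hcount : ∀ x, M.count x = if x = 0 then 2 else if x ≤ n then 1 else 0 := by
    intro x
    by_cases hx : x = n + 1
    · subst hx
      rw [h0, if_neg (by omega), if_neg (by omega)]
    · exact h.1 x hx
  obtain ⟨-, h2, h3, -, -⟩ := h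
  rcases M with _ | ⟨c, N⟩
  · simp at h2
  obtain rfl : c = 0 := by simpa using h2
  rcases List.eq_nil_or_concat' N with rfl | ⟨N, d, rfl⟩
  · have := hcount 0
    simp at this
  obtain rfl : d = 0 := by simpa [List.getLast?_cons] using h3
  have hN : ∀ x, N.count x = if x ∈ Icc 1 n then 1 else 0 := by
    intro x
    have := hcount x
    simp only [mem_Icc]
    rcases eq_or_ne x 0 with rfl | hx
    · simpa using this
    · rw [List.count_cons_of_ne hx.symm, List.count_append, List.count_cons_of_ne hx.symm,
        List.count_nil, if_neg hx, add_zero] at this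
      rw [this]
      split_ifs <;> omega
  have hnd : N.Nodup := List.nodup_iff_count_le_one.2 fun x => by
    rw [hN]; split_ifs <;> omega
  have hmem : ∀ x ∈ N, x ∈ Icc 1 n := fun x hx => by
    have h4 := List.count_pos_iff.2 hx
    rw [hN] at h4
    by_contra h5
    rw [if_neg h5] at h4
    omega
  have hlen : N.length = n := by
    have : N.toFinset = Icc 1 n := by
      ext x
      rw [List.mem_toFinset]
      refine ⟨hmem x, fun hx => List.count_pos_iff.1 ?_⟩
      rw [hN, if_pos hx]
      exact one_pos
    rw [← List.toFinset_card_of_nodup hnd, this, Nat.card_Icc, Nat.add_sub_cancel]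
  have hget : ∀ i : Fin n, 1 ≤ N[(i : ℕ)]'(by omega) ∧ N[(i : ℕ)]'(by omega) ≤ n := fun i =>
    mem_Icc.1 (hmem _ (List.getElem_mem _))
  let f : Fin n → Fin n := fun i => ⟨N[(i : ℕ)]'(by omega) - 1, by have := hget i; omega⟩
  have hinj : Function.Injective f := by
    intro i j e
    have e' : N[(i : ℕ)]'(by omega) - 1 = N[(j : ℕ)]'(by omega) - 1 := Fin.mk.inj e
    have h4 := hget i
    have h5 := hget j
    exact Fin.ext (hnd.getElem_inj_iff.1 (by omega))
  let σ : Equiv.Perm (Fin n) := Equiv.ofBijective f (Finite.injective_iff_bijective.1 hinj)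
  refine ⟨σ, List.ext_getElem (by simp [paddedWord, hlen]) fun i h4 h5 => ?_⟩
  have hi : i < n + 2 := by simpa [paddedWord] using h4
  simp only [paddedWord, List.getElem_map, List.getElem_range', zero_add, one_mul]
  rcases i with _ | i
  · exact word_zero σ
  · rw [List.getElem_cons_succ, List.getElem_append]
    split_ifs with h6
    · rw [hlen] at h6
      rw [word_succ σ h6]
      have := (hget ⟨i, h6⟩).1
      exact Nat.sub_add_cancel this
    · rw [List.getElem_singleton]
      exact word_of_lt σ (by omega)

/-- The value `n + 1` serves as the hole, being larger than every letter. The test function selects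
the words with all holes closed and `k + 1` descents, one of them due to the padding. -/
theorem gammaPoly_eq_wordSum (n k : ℕ) (hn : 0 < n) :
    gammaPoly n k = wordSum (n + 1) n (pointMass 0 (k + 1)) := by
  have e : wordSum (n + 1) n (pointMass 0 (k + 1)) =
      ∑ M ∈ holedWords (n + 1) n with M.count (n + 1) = 0 ∧ countDes M = k + 1,
        X ^ wordWeight M := by
    rw [wordSum, sum_filter]
    refine sum_congr rfl fun M _ => ?_
    simp only [pointMass, mul_ite, mul_one, mul_zero]
  rw [e, gammaPoly]
  refine sum_nbij paddedWord (fun σ hσ => ?_) paddedWord_injective.injOn (fun M hM => ?_)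
    fun σ _ => by rw [wordWeight_paddedWord]
  · obtain ⟨-, h1, h2⟩ := mem_filter.1 hσ
    refine mem_filter.2 ⟨(mem_holedWords (Nat.lt_succ_self n)).2
      ⟨isHoled_paddedWord σ h2, fun h => absurd h hn.ne'⟩,
      List.count_eq_zero.2 (succ_notMem_paddedWord σ), ?_⟩
    rw [countDes_paddedWord σ hn, h1]
  · obtain ⟨h1, h2, h3⟩ := mem_filter.1 (mem_coe.1 hM)
    have h4 := ((mem_holedWords (Nat.lt_succ_self n)).1 h1).1
    obtain ⟨σ, rfl⟩ := exists_paddedWord_eq h4 h2 hn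
    refine ⟨σ, ?_, rfl⟩
    simp only [DD, coe_filter, mem_univ, true_and, Set.mem_ofPred_eq]
    rw [countDes_paddedWord σ hn] at h3
    exact ⟨Nat.add_right_cancel h3, by rw [← countDD_paddedWord]; exact h4.2.2.2.2⟩

theorem gammaPoly_eq_sum_SDE (n k : ℕ) (hn : 0 < n) :
    gammaPoly n k = ∑ σ ∈ SDE n k, (X : ℤ[X]) ^ (inv σ - exc σ) := by
  obtain ⟨m, rfl⟩ : ∃ m, n = m + 1 := ⟨n - 1, by omega⟩
  rw [gammaPoly_eq_wordSum _ _ hn, wordSum_eq _ (Nat.lt_succ_self _),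
    wordStep_iterate_eq_rookStep_iterate, sum_SDE_eq_rookSum, rookSum_eq]

end PermStat

theorem mainTheorem12 (n k : ℕ) (hk : 2 * k + 1 ≤ n) :
    PermStat.gammaPoly n k =
        ∑ σ ∈ PermStat.DEStar n k, (X : ℤ[X]) ^ (PermStat.inv σ - PermStat.exc σ) ∧
      PermStat.gammaPoly n k =
        ∑ σ ∈ PermStat.SDE n k, (X : ℤ[X]) ^ (PermStat.inv σ - PermStat.exc σ) := by
  have h := PermStat.gammaPoly_eq_sum_SDE n k (by omega)
  rw [PermStat.DEStar_eq_SDE]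
  exact ⟨h, h⟩
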